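/- Let $q_1,\dots,q_n\colon[t_0,T)\to\mathbb{R}^2=\mathbb{C}$ be a collision-free solution of the planar Newtonian $n$-body problem with masses $m_i>0$, $m_i\ddot q_i=\partial U/\partial q_i$, $U=\sum_{i<j}m_im_j/|q_i-q_j|$, with a partial collision at time $T$: all limits $L_i=\lim_{t\nearrow T}q_i(t)$ exist, and $\mathcal G$ is a cluster (the set of all $i$ with $L_i=L_{\mathcal G}$, for some point $L_{\mathcal G}$) with $1<k=\#\mathcal G<n$; say $\mathcal G=\{1,\dots,k\}$. *Coordinates.* Let $c=c_{\mathcal G}$ be the centre of mass of $\mathcal G$, $r=\big(\sum_{i\in\mathcal G}m_i|q_i-c|^2\big)^{1/2}$, and $\hat q_{\mathcal G}=\big((q_i-c)/r\big)_{i\in\mathcal G}$. Let $(q_i)_{i\in\mathcal G}=Pz$, $z\in\mathbb{C}^k$, be generalized Jacobi coordinates, that is, $P$ is an invertible complex matrix such that $z_k=c$ and $\sum_{i\in\mathcal G}m_i|q_i|^2=\bar{\mathfrak z}^T\tilde M\mathfrak z+\big(\sum_{i\in\mathcal G}m_i\big)|c|^2$ with $\mathfrak z=(z_1,\dots,z_{k-1})$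 and $\tilde M$ the upper left $(k-1)\times(k-1)$ block of $\bar P^T\mathrm{diag}(m_1,\dots,m_k)P$. Put $\langle\langle u,w\rangle\rangle=\bar u^T\tilde M w$ and $\|u\|^2=\langle\langle u,u\rangle\rangle$ on $\mathbb{C}^{k-1}$. Where $z_{k-1}\ne0$, define $\theta$ and $s\in\mathbb{C}^{k-2}=\mathbb{R}^{2(k-2)}$ by $\mathfrak z=re^{i\theta}(s,1)/\|(s,1)\|$. For $\omega\in\mathbb{C}^{k-2}$ put $G(s,\omega)=\operatorname{Re}\langle\langle(s,1),(\omega,0)\rangle\rangle$ and $\Omega(s,\omega)=\operatorname{Im}\langle\langle(s,1),(\omega,0)\rangle\rangle=\mathcal B(s)^T\omega$, and let $\mathcal A(s)$ be the real symmetric matrix with $$\omega^T\mathcal A(s)\omega=\frac{\|(\omega,0)\|^2}{\|(s,1)\|^2}-\frac{G(s,\omega)^2+\Omega(s,\omega)^2}{\|(s,1)\|^4}.$$ Let $\mu=r^2\dot\theta+r^2\Omega(s,\dot s)/\|(s,1)\|^2$, let $U_{\rm ext}=\sum_{i\in\mathcal G,\,j\notin\mathcal G}m_im_j/|q_i-q_j|$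 be regarded as a function of $(r,\theta,s,c)$ and of $q_j$, $j\notin\mathcal G$, and let $\tau(t)=\int_{t_0}^t r^{-3/2}\,du$. *Assumption.* Every limit point of $\hat q_{\mathcal G}(t)$ as $t\nearrow T$ lies in the domain $\{z_{k-1}\neq0\}$ of the coordinates. *Claim.* Then $\tau(t)\to\infty$ as $t\nearrow T$, and there are constants $C,E>0$ and $\tau_0$ such that at all times with $\tau\ge\tau_0$ the orbit lies in the domain $\{z_{k-1}\ne 0\}$ and $$\max\left\{\left|\frac{\mu^2}{r}+r^2\frac{\partial U_{\rm ext}}{\partial r}\right|,\ \left\|r^2\frac{\partial U_{\rm ext}}{\partial s}-r\dot\mu\,\frac{\mathcal A(s)^{-1}\mathcal B(s)}{\|(s,1)\|^2}\right\|\right\}\le Ce^{-E\tau},$$ and also $$\left\|r\,\mathcal A(s)^{-1}\frac{\partial U_{\rm ext}}{\partial s}-r\dot\mu\,\frac{\mathcal A(s)^{-1}\mathcal B(s)}{\|(s,1)\|^2}\right\|\le Ce^{-E\tau}.$$ -/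

import Mathlib

open Filter Topology Set

noncomputable section

namespace PartialCollision

/-! ### Orbits of the planar `n`-body problem; the plane is identified with `ℂ` -/

/-- The curve of positions `q` and velocities `v` solves Newton's equations
`m_i q̈_i = ∂U/∂q_i = ∑_{j ≠ i} m_i m_j (q_j - q_i) / |q_j - q_i|³` on `[t₀, T)`. -/
structure IsOrbit {n : ℕ} (m : Fin n → ℝ) (q v : ℝ → Fin n → ℂ) (t₀ T : ℝ) : Prop where
  noncollision : ∀ t ∈ Ico t₀ T, ∀ i j, i ≠ j → q t i ≠ q t j
  velocity : ∀ t ∈ Ico t₀ T, ∀ i,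
    HasDerivWithinAt (fun u => q u i) (v t i) (Ico t₀ T) t
  newton : ∀ t ∈ Ico t₀ T, ∀ i,
    HasDerivWithinAt (fun u => v u i)
      (∑ j ∈ Finset.univ.erase i, (m j / ‖q t j - q t i‖ ^ 3) • (q t j - q t i)) (Ico t₀ T) t

/-- All bodies have limit positions as `t ↗ T`, and the bodies `e 0, …, e (k-1)`, `k = p + 2`,
form a complete cluster of colliding bodies which does not consist of all `n` bodies. -/
structure IsPartialCollision {n p : ℕ} (q : ℝ → Fin n → ℂ) (T : ℝ)
    (e : Fin (p + 2) ↪ Fin n) : Prop where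
  lt : p + 2 < n
  exists_limit : ∃ L : Fin n → ℂ, (∀ i, Tendsto (fun t => q t i) (𝓝[<] T) (𝓝 (L i))) ∧
    ∀ i, i ∈ range e ↔ L i = L (e 0)

/-! ### The cluster: size, normalized configuration, generalized Jacobi coordinates -/

/-- Centre of mass of a configuration `x` with masses `w`. -/
def centerOfMass {k : ℕ} (w : Fin k → ℝ) (x : Fin k → ℂ) : ℂ :=
  (∑ i, w i)⁻¹ • ∑ i, w i • x i

/-- The size `r`: square root of the intrinsic moment of inertia. -/
def size {k : ℕ} (w : Fin k → ℝ) (x : Fin k → ℂ) : ℝ :=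
  Real.sqrt (∑ i, w i * ‖x i - centerOfMass w x‖ ^ 2)

/-- The normalized configuration `(x_i - c) / r`. -/
def normalized {k : ℕ} (w : Fin k → ℝ) (x : Fin k → ℂ) : Fin k → ℂ :=
  fun i => (size w x)⁻¹ • (x i - centerOfMass w x)

/-- The Hermitian mass matrix of the relative coordinates `(z_1, …, z_{k-1})`: the block of
`Pᴴ diag(w) P` obtained by deleting the last row and the last column. -/
def relMass {p : ℕ} (w : Fin (p + 2) → ℝ) (P : Matrix (Fin (p + 2)) (Fin (p + 2)) ℂ) :
    Matrix (Fin (p + 1)) (Fin (p + 1)) ℂ :=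
  (P.conjTranspose * Matrix.diagonal (fun i => (w i : ℂ)) * P).submatrix
    Fin.castSucc Fin.castSucc

/-- The Hermitian form `⟨⟨u, v⟩⟩ = ūᵀ M v`. -/
def herm {k : ℕ} (M : Matrix (Fin k) (Fin k) ℂ) (u v : Fin k → ℂ) : ℂ :=
  star u ⬝ᵥ M.mulVec v

/-- `x = P z` are generalized Jacobi coordinates for a cluster with masses `w`. Being
complex-linear, they commute with rotations of the plane; the last coordinate is the centre of
mass, and the moment of inertia splits into a relative part and that of the centre of mass. -/
structure IsJacobi {p : ℕ} (w : Fin (p + 2) → ℝ)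
    (P : Matrix (Fin (p + 2)) (Fin (p + 2)) ℂ) : Prop where
  isUnit_det : IsUnit P.det
  last_eq : ∀ z, z (Fin.last (p + 1)) = centerOfMass w (P.mulVec z)
  inertia : ∀ z, ∑ i, w i * ‖P.mulVec z i‖ ^ 2 =
    (herm (relMass w P) (fun j => z j.castSucc) (fun j => z j.castSucc)).re
      + (∑ i, w i) * ‖z (Fin.last (p + 1))‖ ^ 2

/-- The relative coordinates `(z_1, …, z_{k-1})` of a configuration. -/
def relCoord {p : ℕ} (P : Matrix (Fin (p + 2)) (Fin (p + 2)) ℂ) (x : Fin (p + 2) → ℂ) :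
    Fin (p + 1) → ℂ :=
  fun j => P⁻¹.mulVec x j.castSucc

/-! ### Shape coordinates `s ∈ ℂ^{k-2} = ℝ^{2(k-2)}` and the associated tensors -/

/-- `ℝ^{2(k-2)}`, `k = p + 2`; the pair `(j, 0)`, `(j, 1)` of coordinates is the real and the
imaginary part of the `j`-th complex coordinate. -/
abbrev Shape (p : ℕ) : Type := EuclideanSpace ℝ (Fin p × Fin 2)

def toC {p : ℕ} (s : Shape p) : Fin p → ℂ := fun j => ⟨s (j, 0), s (j, 1)⟩

def ofC {p : ℕ} (z : Fin p → ℂ) : Shape p :=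
  WithLp.toLp 2 fun a => if a.2 = 0 then (z a.1).re else (z a.1).im

/-- The vector `(s, a) ∈ ℂ^{k-1}`. -/
def vecExt {p : ℕ} (s : Shape p) (a : ℂ) : Fin (p + 1) → ℂ :=
  Fin.snoc (α := fun _ => ℂ) (toC s) a

/-- `‖(s, 1)‖` in the norm of the Hermitian form. -/
def normOne {p : ℕ} (M : Matrix (Fin (p + 1)) (Fin (p + 1)) ℂ) (s : Shape p) : ℝ :=
  Real.sqrt (herm M (vecExt s 1) (vecExt s 1)).re

/-- `G(s, ω) = Re ⟨⟨(s, 1), (ω, 0)⟩⟩`. -/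
def GG {p : ℕ} (M : Matrix (Fin (p + 1)) (Fin (p + 1)) ℂ) (s ω : Shape p) : ℝ :=
  (herm M (vecExt s 1) (vecExt ω 0)).re

/-- `Ω(s, ω) = Im ⟨⟨(s, 1), (ω, 0)⟩⟩`. -/
def Om {p : ℕ} (M : Matrix (Fin (p + 1)) (Fin (p + 1)) ℂ) (s ω : Shape p) : ℝ :=
  (herm M (vecExt s 1) (vecExt ω 0)).im

/-- The `a`-th standard basis vector of `ℝ^{2(k-2)}`. -/
def basisVec {p : ℕ} (a : Fin p × Fin 2) : Shape p := EuclideanSpace.single a 1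

/-- The vector `𝓑(s)`, with `Ω(s, ω) = 𝓑(s)ᵀ ω`. -/
def BB {p : ℕ} (M : Matrix (Fin (p + 1)) (Fin (p + 1)) ℂ) (s : Shape p) : Fin p × Fin 2 → ℝ :=
  fun a => Om M s (basisVec a)

/-- The symmetric matrix `𝓐(s)` of the Fubini–Study quadratic form
`F(s, ω) = ‖ω‖² / ‖(s,1)‖² - (G(s,ω)² + Ω(s,ω)²) / ‖(s,1)‖⁴`. -/
def AA {p : ℕ} (M : Matrix (Fin (p + 1)) (Fin (p + 1)) ℂ) (s : Shape p) :
    Matrix (Fin p × Fin 2) (Fin p × Fin 2) ℝ :=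
  Matrix.of fun a b =>
    (herm M (vecExt (basisVec a) 0) (vecExt (basisVec b) 0)).re / normOne M s ^ 2
      - (GG M s (basisVec a) * GG M s (basisVec b) + Om M s (basisVec a) * Om M s (basisVec b))
        / normOne M s ^ 4

/-! ### The external potential in the coordinates `(r, θ, s, c)` -/

/-- The configuration of the cluster with coordinates `(r, θ, s)` and centre of mass `c`:
`(z_1, …, z_{k-1}) = r e^{iθ} (s, 1) / ‖(s, 1)‖`, `z_k = c`. -/
def chart {p : ℕ} (w : Fin (p + 2) → ℝ) (P : Matrix (Fin (p + 2)) (Fin (p + 2)) ℂ)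
    (r θ : ℝ) (s : Shape p) (c : ℂ) : Fin (p + 2) → ℂ :=
  P.mulVec (Fin.snoc (α := fun _ => ℂ)
    (fun j => (r : ℂ) * Complex.exp (θ * Complex.I) * vecExt s 1 j / normOne (relMass w P) s) c)

open Classical in
/-- `U_ext`: interaction of the cluster, placed at `y`, with the bodies outside the cluster,
placed as in `Q`. -/
def extPotential {n p : ℕ} (m : Fin n → ℝ) (e : Fin (p + 2) ↪ Fin n)
    (y : Fin (p + 2) → ℂ) (Q : Fin n → ℂ) : ℝ :=
  ∑ i, ∑ j ∈ Finset.univ.filter (fun j => j ∉ range e), m (e i) * m j / ‖y i - Q j‖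

/-- `U_ext` as a function of `(r, θ, s, c)` and of the positions of the external bodies. -/
def UExt {n p : ℕ} (m : Fin n → ℝ) (e : Fin (p + 2) ↪ Fin n)
    (P : Matrix (Fin (p + 2)) (Fin (p + 2)) ℂ) (Q : Fin n → ℂ) (r θ : ℝ) (s : Shape p) (c : ℂ) :
    ℝ :=
  extPotential m e (chart (m ∘ e) P r θ s c) Q

/-! ### Quantities along an orbit -/

section Along

variable {n p : ℕ} (m : Fin n → ℝ) (e : Fin (p + 2) ↪ Fin n)
  (P : Matrix (Fin (p + 2)) (Fin (p + 2)) ℂ) (q : ℝ → Fin n → ℂ)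

/-- The configuration of the cluster at time `t`. -/
def cluster (t : ℝ) : Fin (p + 2) → ℂ := fun i => q t (e i)

/-- The normalized configuration of the cluster at time `t`. -/
def qHat (t : ℝ) : Fin (p + 2) → ℂ := normalized (m ∘ e) (cluster e q t)

def rr (t : ℝ) : ℝ := size (m ∘ e) (cluster e q t)

def cc (t : ℝ) : ℂ := centerOfMass (m ∘ e) (cluster e q t)

/-- The coordinate `z_{k-1}`, whose argument is `θ`. -/
def zTop (t : ℝ) : ℂ := relCoord P (cluster e q t) (Fin.last p)

def theta (t : ℝ) : ℝ := (zTop e P q t).arg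

/-- `θ̇`, as the imaginary part of the logarithmic derivative of `z_{k-1} = |z_{k-1}| e^{iθ}`
(so that the jumps of the principal argument play no role). -/
def thetaDot (t : ℝ) : ℝ := (deriv (zTop e P q) t / zTop e P q t).im

/-- The shape coordinates `s_j = z_j / z_{k-1}`. -/
def ss (t : ℝ) : Shape p :=
  ofC fun j => relCoord P (cluster e q t) j.castSucc / zTop e P q t

/-- `μ = ∂𝓛/∂θ̇ = r² θ̇ + r² Ω(s, ṡ) / ‖(s, 1)‖²`. -/
def mu (t : ℝ) : ℝ :=
  rr m e q t ^ 2 * thetaDot e P q t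
    + rr m e q t ^ 2 * Om (relMass (m ∘ e) P) (ss e P q t) (deriv (ss e P q) t)
      / normOne (relMass (m ∘ e) P) (ss e P q t) ^ 2

/-- The partial derivative `∂U_ext/∂r` along the orbit. -/
def dUdr (t : ℝ) : ℝ :=
  deriv (fun r => UExt m e P (q t) r (theta e P q t) (ss e P q t) (cc m e q t)) (rr m e q t)

/-- The partial derivative (gradient) `∂U_ext/∂s` along the orbit. -/
def dUds (t : ℝ) : Shape p :=
  gradient (fun s => UExt m e P (q t) (rr m e q t) (theta e P q t) s (cc m e q t)) (ss e P q t)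

/-- `𝓐(s)⁻¹ 𝓑(s) / ‖(s, 1)‖²` along the orbit. -/
def ABn (t : ℝ) : Shape p :=
  (normOne (relMass (m ∘ e) P) (ss e P q t) ^ 2)⁻¹ •
    WithLp.toLp 2 ((AA (relMass (m ∘ e) P) (ss e P q t))⁻¹.mulVec
      (BB (relMass (m ∘ e) P) (ss e P q t)))

/-- `𝓐(s)⁻¹ ∂U_ext/∂s` along the orbit. -/
def AdUds (t : ℝ) : Shape p :=
  WithLp.toLp 2 ((AA (relMass (m ∘ e) P) (ss e P q t))⁻¹.mulVec (dUds m e P q t).ofLp)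

/-- The regularized time `τ(t)`, with `dτ = r^{-3/2} dt` and `τ(t₀) = 0`. -/
def tau (t₀ t : ℝ) : ℝ := ∫ u in t₀..t, rr m e q u ^ (-(3 / 2) : ℝ)

end Along

end PartialCollision

end

noncomputable section

namespace PartialCollision

/-! Every quantity to be estimated is `O(r)`, and `r` decays exponentially in `τ`. Convergence of
the normalized configuration is not needed: it suffices that the shape stays bounded.

Decay of `r` is Sundman's theory of total collapse, made stable under bounded external forces. Write
`J = r ṙ`, let `k` be the squared speed relative to the centre of mass and `a` the intrinsic angular
momentum. The internal energy of the cluster is not conserved, and its rate of change is controlled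
only by the speed, which may be unbounded. The Lagrange–Jacobi identity compensates: `J̇ = k - U +
R` with bounded `R`, so adding `J` to the energy absorbs the loss. This bounds the energy below up
to a multiple of `J`, hence gives `J < 0` and convexity of the moment of inertia near `T`. Monotone
quantities then show that `J²` lies between two multiples of `r`. Since `ȧ = O(r)` with `r`
decreasing, and since a limit of `a` other than zero would be a barrier to collapse, also `a = O(r)`
(`IsCollapse.asymptotics`). As `(log r)˙ = J / r²` is of order `-r^{-3/2} = -τ̇`, `log r` lies
between two decreasing affine functions of `τ` (`regularizedTime_asymptotics`).

The rest identifies the terms. The momentum `μ` equals `a` (`mu_eq`), so `μ²/r` and `μ̇` are `O(r)`.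
The assumption on limit points and compactness keep `s` bounded (`exists_ss_le`), and `𝓐(s)` is
invertible and continuous in `s`, so `𝓐⁻¹` and `𝓐⁻¹𝓑/‖(s,1)‖²` are bounded (`exists_shape_bounds`).
The other bodies stay away from the cluster, and a change of `s` moves the cluster only by a
multiple of `r`; hence `∂U_ext/∂r = O(1)` and `∂U_ext/∂s = O(r)` (`exists_dU_le`). -/

/-! ### Monotonicity on open intervals and one-sided neighbourhoods. -/

theorem monotoneOn_Ioo_of_hasDerivAt {f f' : ℝ → ℝ} {a b : ℝ}
    (hf : ∀ t ∈ Ioo a b, HasDerivAt f (f' t) t) (h0 : ∀ t ∈ Ioo a b, 0 ≤ f' t) :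
    MonotoneOn f (Ioo a b) := by
  refine monotoneOn_of_deriv_nonneg (convex_Ioo a b)
    (fun t ht => (hf t ht).continuousAt.continuousWithinAt) ?_ ?_
  · rw [interior_Ioo]
    exact fun t ht => (hf t ht).differentiableAt.differentiableWithinAt
  · rw [interior_Ioo]
    intro t ht
    rw [(hf t ht).deriv]
    exact h0 t ht

theorem antitoneOn_Ioo_of_hasDerivAt {f f' : ℝ → ℝ} {a b : ℝ}
    (hf : ∀ t ∈ Ioo a b, HasDerivAt f (f' t) t) (h0 : ∀ t ∈ Ioo a b, f' t ≤ 0) :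
    AntitoneOn f (Ioo a b) := by
  have := monotoneOn_Ioo_of_hasDerivAt (f := fun t => -f t) (f' := fun t => -f' t)
    (fun t ht => (hf t ht).neg) (fun t ht => neg_nonneg.2 (h0 t ht))
  intro x hx y hy hxy
  exact neg_le_neg_iff.1 (this hx hy hxy)

theorem exists_Ioo_of_eventually {P : ℝ → Prop} {a T : ℝ} (ha : a < T)
    (h : ∀ᶠ t in 𝓝[<] T, P t) : ∃ b ∈ Ioo a T, ∀ t ∈ Ioo b T, P t := by
  obtain ⟨l, hl, hP⟩ := (mem_nhdsLT_iff_exists_Ioo_subset' ha).1 h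
  have h1 : max l a < T := max_lt hl ha
  refine ⟨(max l a + T) / 2, ⟨?_, by linarith⟩, fun t ht => hP ⟨?_, ht.2⟩⟩
  · linarith [le_max_right l a]
  · linarith [le_max_left l a, ht.1]

/-! ### Sundman's analysis of a perturbed total collapse. -/

/-- The scalar quantities entering Sundman's analysis of a (perturbed) total collapse: size `r`,
`J = r ṙ`, squared speed `k`, potential `U`, angular momentum `a`, with bounded perturbations. -/
structure IsCollapse (r J k U R h' a a' : ℝ → ℝ) (t₁ T C c : ℝ) : Prop where
  lt : t₁ < T
  c_pos : 0 < c
  r_pos : ∀ t ∈ Ioo t₁ T, 0 < r t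
  hasDerivAt_r : ∀ t ∈ Ioo t₁ T, HasDerivAt r (J t / r t) t
  hasDerivAt_J : ∀ t ∈ Ioo t₁ T, HasDerivAt J (k t - U t + R t) t
  hasDerivAt_energy : ∀ t ∈ Ioo t₁ T, HasDerivAt (fun u => k u / 2 - U u) (h' t) t
  energy_ge : ∀ t ∈ Ioo t₁ T, -(k t / 2) - C ≤ h' t
  abs_R_le : ∀ t ∈ Ioo t₁ T, |R t| ≤ C
  U_ge : ∀ t ∈ Ioo t₁ T, c / r t ≤ U t
  hasDerivAt_a : ∀ t ∈ Ioo t₁ T, HasDerivAt a (a' t) t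
  abs_a'_le : ∀ t ∈ Ioo t₁ T, |a' t| ≤ C * r t
  sundman : ∀ t ∈ Ioo t₁ T, J t ^ 2 + a t ^ 2 ≤ r t ^ 2 * k t
  tendsto_r : Tendsto r (𝓝[<] T) (𝓝 0)

namespace IsCollapse

variable {r J k U R h' a a' : ℝ → ℝ} {t₁ T C c : ℝ}

theorem mono (H : IsCollapse r J k U R h' a a' t₁ T C c) {t₂ : ℝ} (h : t₂ ∈ Ioo t₁ T) :
    IsCollapse r J k U R h' a a' t₂ T C c := by
  have hs : ∀ t ∈ Ioo t₂ T, t ∈ Ioo t₁ T := fun t ht => ⟨h.1.trans ht.1, ht.2⟩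
  exact ⟨h.2, H.c_pos, fun t ht => H.r_pos t (hs t ht), fun t ht => H.hasDerivAt_r t (hs t ht),
    fun t ht => H.hasDerivAt_J t (hs t ht), fun t ht => H.hasDerivAt_energy t (hs t ht),
    fun t ht => H.energy_ge t (hs t ht), fun t ht => H.abs_R_le t (hs t ht),
    fun t ht => H.U_ge t (hs t ht), fun t ht => H.hasDerivAt_a t (hs t ht),
    fun t ht => H.abs_a'_le t (hs t ht), fun t ht => H.sundman t (hs t ht), H.tendsto_r⟩

theorem C_nonneg (H : IsCollapse r J k U R h' a a' t₁ T C c) : 0 ≤ C := by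
  have ht : (t₁ + T) / 2 ∈ Ioo t₁ T := ⟨by linarith [H.lt], by linarith [H.lt]⟩
  exact (abs_nonneg _).trans (H.abs_R_le _ ht)

theorem eventually_r_lt (H : IsCollapse r J k U R h' a a' t₁ T C c) {ε : ℝ} (hε : 0 < ε) :
    ∃ t₂ ∈ Ioo t₁ T, ∀ t ∈ Ioo t₂ T, r t < ε :=
  exists_Ioo_of_eventually H.lt (H.tendsto_r.eventually (gt_mem_nhds hε))

/-- The energy of the collapsing system is bounded below, up to a multiple of `J`. -/
theorem exists_energy_ge (H : IsCollapse r J k U R h' a a' t₁ T C c) :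
    ∃ t₂ ∈ Ioo t₁ T, ∃ D, ∀ t ∈ Ioo t₂ T, -J t - D ≤ k t / 2 - U t := by
  obtain ⟨t₂, ht₂, hr⟩ := H.eventually_r_lt one_pos
  have H := H.mono ht₂
  have hC := H.C_nonneg
  -- With `F = (k/2 - U) + J + r²/2`, the term `k/2` in `J̇` cancels the loss `-k/2` of energy, and
  -- `r²/2`, whose derivative is `J`, makes `F` reappear: `Ḟ ≥ F - (2C + 1)`. Multiplying by the
  -- integrating factor `e^{-t}` gives the monotone function `f`; the sign of `J` is not needed.
  set B := Real.exp (-t₂) * (2 * C + 1) with hB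
  have hB0 : 0 ≤ B := by positivity
  set f : ℝ → ℝ := fun t => Real.exp (-t) * ((k t / 2 - U t) + J t + r t ^ 2 / 2) + B * t with hf
  have hmono : MonotoneOn f (Ioo t₂ T) := by
    refine monotoneOn_Ioo_of_hasDerivAt (f' := fun t =>
      (Real.exp (-t) * (-1)) * ((k t / 2 - U t) + J t + r t ^ 2 / 2) +
        Real.exp (-t) * (h' t + (k t - U t + R t) + (2 * r t * (J t / r t)) / 2) + B * 1) ?_ ?_
    · intro t ht
      have h1 : HasDerivAt (fun u : ℝ => Real.exp (-u)) (Real.exp (-t) * (-1)) t :=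
        (hasDerivAt_neg t).exp
      have h2 : HasDerivAt (fun u => r u ^ 2 / 2) ((2 * r t * (J t / r t)) / 2) t := by
        have := ((H.hasDerivAt_r t ht).pow 2).div_const 2
        simpa using this
      exact (h1.mul (((H.hasDerivAt_energy t ht).add (H.hasDerivAt_J t ht)).add h2)).add
        ((hasDerivAt_id t).const_mul B)
    · intro t ht
      have hrp := H.r_pos t ht
      have e1 : 2 * r t * (J t / r t) / 2 = J t := by field_simp
      rw [e1]
      have h1 := H.energy_ge t ht
      have h2 := (abs_le.1 (H.abs_R_le t ht)).1
      have h3 : r t ^ 2 ≤ 1 := by nlinarith [hr t ht]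
      have h4 : Real.exp (-t) ≤ Real.exp (-t₂) := Real.exp_le_exp.2 (by linarith [ht.1])
      have h5 : -(2 * C + 1) ≤ h' t + (k t - U t + R t) - (k t / 2 - U t) - r t ^ 2 / 2 := by
        linarith
      have h6 : Real.exp (-t) * (2 * C + 1) ≤ B :=
        mul_le_mul_of_nonneg_right h4 (by positivity)
      have h7 := mul_le_mul_of_nonneg_left h5 (Real.exp_pos (-t)).le
      nlinarith
  have hm : (t₂ + T) / 2 ∈ Ioo t₂ T := ⟨by linarith [H.lt], by linarith [H.lt]⟩
  set tm := (t₂ + T) / 2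
  refine ⟨tm, ⟨ht₂.1.trans hm.1, hm.2⟩, Real.exp T * |f tm - B * T| + 1, fun t ht => ?_⟩
  have htt : t ∈ Ioo t₂ T := ⟨hm.1.trans ht.1, ht.2⟩
  have h1 := hmono hm htt ht.1.le
  have h2 : B * t ≤ B * T := mul_le_mul_of_nonneg_left ht.2.le hB0
  set E := (k t / 2 - U t) + J t + r t ^ 2 / 2 with hE
  have h3 : f tm - B * T ≤ Real.exp (-t) * E := by
    have : f t = Real.exp (-t) * E + B * t := rfl
    linarith
  have h4 : Real.exp t * (f tm - B * T) ≤ E := by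
    have := mul_le_mul_of_nonneg_left h3 (Real.exp_pos t).le
    rwa [← mul_assoc, ← Real.exp_add, add_neg_cancel, Real.exp_zero, one_mul] at this
  have h5 : -(Real.exp T * |f tm - B * T|) ≤ Real.exp t * (f tm - B * T) := by
    have h6 : Real.exp t * |f tm - B * T| ≤ Real.exp T * |f tm - B * T| := by
      gcongr
      exact ht.2.le
    have h7 := mul_le_mul_of_nonneg_left (neg_abs_le (f tm - B * T)) (Real.exp_pos t).le
    linarith
  have h3 : r t ^ 2 ≤ 1 := by nlinarith [hr t htt, H.r_pos t htt]
  linarith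

/-- Near the collapse the size decreases, and the moment of inertia is uniformly convex. -/
theorem exists_J_neg (H : IsCollapse r J k U R h' a a' t₁ T C c) :
    ∃ t₂ ∈ Ioo t₁ T, ∃ D, 0 ≤ D ∧ ∀ t ∈ Ioo t₂ T, J t < 0 ∧ c / (2 * r t) ≤ k t - U t + R t ∧
      k t / 2 - D ≤ k t - U t + R t := by
  obtain ⟨t₂, ht₂, D, hD⟩ := H.exists_energy_ge
  have H' := H.mono ht₂
  have hc := H.c_pos
  have hC := H.C_nonneg
  set B := 2 * |D| + C + 1 with hB
  have hB0 : 0 < B := by positivity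
  obtain ⟨t₃, ht₃, hr⟩ := H'.eventually_r_lt (ε := c / (2 * B)) (by positivity)
  have H' := H'.mono ht₃
  -- Write `k - U + R = 2(k/2 - U) + U + R`. One half of `U ≥ c/r` absorbs the constants collected
  -- in `B`, the other half is kept.
  have key : ∀ t ∈ Ioo t₃ T, c / (2 * r t) - 2 * J t ≤ k t - U t + R t := by
    intro t ht
    have hrp := H'.r_pos t ht
    have h1 := H'.U_ge t ht
    have h2 := hD t ⟨ht₃.1.trans ht.1, ht.2⟩
    have h3 := (abs_le.1 (H'.abs_R_le t ht)).1
    have h4 : B ≤ c / (2 * r t) := by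
      rw [le_div_iff₀ (by positivity)]
      have := (lt_div_iff₀ (by positivity)).1 (hr t ht)
      linarith
    have h5 : c / r t = c / (2 * r t) + c / (2 * r t) := by field_simp; ring
    have h6 := le_abs_self D
    linarith
  have hmono : MonotoneOn (fun t => Real.exp (2 * t) * J t) (Ioo t₃ T) := by
    refine monotoneOn_Ioo_of_hasDerivAt (f' := fun t =>
      (Real.exp (2 * t) * (2 * 1)) * J t + Real.exp (2 * t) * (k t - U t + R t)) ?_ ?_
    · intro t ht
      exact (((hasDerivAt_id t).const_mul 2).exp).mul (H'.hasDerivAt_J t ht)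
    · intro t ht
      have h1 := key t ht
      have h2 : 0 < c / (2 * r t) := by have := H'.r_pos t ht; positivity
      have h3 : 0 ≤ 2 * J t + (k t - U t + R t) := by linarith
      have := mul_nonneg (Real.exp_pos (2 * t)).le h3
      linarith
  -- Since `e^{2t} J` increases, `J` would remain nonnegative once it is so; then `r` could not tend
  -- to `0`.
  have hJ0 : ∀ t ∈ Ioo t₃ T, J t < 0 := by
    intro t ht
    by_contra! hJ
    have hpos : ∀ u ∈ Ioo t T, 0 ≤ J u := by
      intro u hu
      have h1 := hmono ht ⟨ht.1.trans hu.1, hu.2⟩ hu.1.le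
      have h2 : 0 ≤ Real.exp (2 * u) * J u :=
        (mul_nonneg (Real.exp_pos _).le hJ).trans h1
      exact nonneg_of_mul_nonneg_right h2 (Real.exp_pos _)
    have hs : ∀ u ∈ Ioo t T, u ∈ Ioo t₃ T := fun u hu => ⟨ht.1.trans hu.1, hu.2⟩
    have hrm : MonotoneOn r (Ioo t T) :=
      monotoneOn_Ioo_of_hasDerivAt (fun u hu => H'.hasDerivAt_r u (hs u hu))
        (fun u hu => div_nonneg (hpos u hu) (H'.r_pos u (hs u hu)).le)
    have hm : (t + T) / 2 ∈ Ioo t T := ⟨by linarith [ht.2], by linarith [ht.2]⟩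
    obtain ⟨t₄, ht₄, h4⟩ := (H'.mono ⟨(ht.1.trans hm.1 : t₃ < (t + T) / 2), hm.2⟩).eventually_r_lt
      (H'.r_pos _ (hs _ hm))
    have hm' : (t₄ + T) / 2 ∈ Ioo t₄ T := ⟨by linarith [ht₄.2], by linarith [ht₄.2]⟩
    have := hrm hm ⟨(hm.1.trans ht₄.1).trans hm'.1, hm'.2⟩ (ht₄.1.trans hm'.1).le
    linarith [h4 _ hm']
  refine ⟨t₃, ⟨ht₂.1.trans ht₃.1, ht₃.2⟩, |D| + C, by positivity, fun t ht => ⟨hJ0 t ht, ?_, ?_⟩⟩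
  · linarith [key t ht, hJ0 t ht]
  · have h2 := hD t ⟨ht₃.1.trans ht.1, ht.2⟩
    have h3 := (abs_le.1 (H'.abs_R_le t ht)).1
    linarith [hJ0 t ht, le_abs_self D]

/-- Asymptotics of a collapse: `r` decreases, `J² = (r ṙ)²` is of the exact order `r`, and the
square of the angular momentum is `O(r²)`. -/
theorem asymptotics (H : IsCollapse r J k U R h' a a' t₁ T C c) :
    ∃ t₂ ∈ Ioo t₁ T, ∃ D, 0 < D ∧ ∀ t ∈ Ioo t₂ T, J t < 0 ∧ c * r t ≤ J t ^ 2 ∧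
      J t ^ 2 ≤ D * r t ∧ a t ^ 2 ≤ D * r t ^ 2 := by
  obtain ⟨t₂, ht₂, D, hD0, hD⟩ := H.exists_J_neg
  have hC := H.C_nonneg
  have hc := H.c_pos
  have H := H.mono ht₂
  have hrm : AntitoneOn r (Ioo t₂ T) :=
    antitoneOn_Ioo_of_hasDerivAt (fun u hu => H.hasDerivAt_r u hu)
      (fun u hu => div_nonpos_of_nonpos_of_nonneg (hD u hu).1.le (H.r_pos u hu).le)
  have hlow : ∀ t ∈ Ioo t₂ T, c * r t ≤ J t ^ 2 := by
    -- The derivative is `2J(J̇ - c/(2r))`. A negative value of this function would persist and keep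
    -- `r` away from `0`.
    have hanti : AntitoneOn (fun t => J t ^ 2 - c * r t) (Ioo t₂ T) := by
      refine antitoneOn_Ioo_of_hasDerivAt (f' := fun t =>
        2 * J t * (k t - U t + R t) - c * (J t / r t)) ?_ ?_
      · intro t ht
        exact (((H.hasDerivAt_J t ht).pow 2).sub ((H.hasDerivAt_r t ht).const_mul c)).congr_deriv
          (by simp)
      · intro t ht
        obtain ⟨h1, h2, -⟩ := hD t ht
        have h3 : c / (2 * r t) = c / r t / 2 := by field_simp
        have h4 : c * (J t / r t) = J t * (c / r t) := by ring
        rw [h4]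
        nlinarith
    intro t ht
    by_contra! hlt
    set ε := (c * r t - J t ^ 2) / c with hε
    have hε0 : 0 < ε := div_pos (by linarith) hc
    obtain ⟨t₄, ht₄, h4⟩ := (H.mono ht).eventually_r_lt hε0
    have hm' : (t₄ + T) / 2 ∈ Ioo t₄ T := ⟨by linarith [ht₄.2], by linarith [ht₄.2]⟩
    have h5 := hanti ht ⟨(ht.1.trans ht₄.1).trans hm'.1, hm'.2⟩ (ht₄.1.trans hm'.1).le
    have h6 := (lt_div_iff₀ hc).1 (h4 _ hm')
    have h7 := sq_nonneg (J ((t₄ + T) / 2))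
    simp only at h5
    linarith
  have hm : (t₂ + T) / 2 ∈ Ioo t₂ T := ⟨by linarith [H.lt], by linarith [H.lt]⟩
  set tm := (t₂ + T) / 2
  have hsun : ∀ t ∈ Ioo t₂ T, J t ^ 2 / r t ^ 2 ≤ k t ∧ a t ^ 2 / r t ^ 2 ≤ k t := by
    intro t ht
    have hrp := H.r_pos t ht
    have := H.sundman t ht
    constructor <;> rw [div_le_iff₀ (by positivity)] <;> nlinarith [sq_nonneg (J t), sq_nonneg (a t)]
  -- The derivative is `2(J/r)(J̇ - J²/(2r²) + D)`, and `J̇ ≥ k/2 - D ≥ J²/(2r²) - D` by Sundman's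
  -- inequality.
  have hup : AntitoneOn (fun t => J t ^ 2 / r t + 2 * D * r t) (Ioo t₂ T) := by
    refine antitoneOn_Ioo_of_hasDerivAt (f' := fun t =>
      (2 * J t * (k t - U t + R t) * r t - J t ^ 2 * (J t / r t)) / r t ^ 2
        + 2 * D * (J t / r t)) ?_ ?_
    · intro t ht
      exact ((((H.hasDerivAt_J t ht).pow 2).div (H.hasDerivAt_r t ht) (H.r_pos t ht).ne').add
        ((H.hasDerivAt_r t ht).const_mul (2 * D))).congr_deriv (by simp)
    · intro t ht
      have hrp := H.r_pos t ht
      obtain ⟨h1, -, h2⟩ := hD t ht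
      have h3 := (hsun t ht).1
      have e : (2 * J t * (k t - U t + R t) * r t - J t ^ 2 * (J t / r t)) / r t ^ 2
        + 2 * D * (J t / r t) = 2 * (J t / r t) * ((k t - U t + R t) - (J t ^ 2 / r t ^ 2) / 2 + D)
        := by field_simp
      rw [e]
      apply mul_nonpos_of_nonpos_of_nonneg
      · have := div_nonpos_of_nonpos_of_nonneg h1.le hrp.le
        linarith
      · linarith
  -- After time `t` the angular momentum changes by at most `C r(t) (T - t)`, because `r` decreases.
  -- If the bound failed, `|a|` would stay above some `δ > 0` up to `T`.
  have ha : ∀ t ∈ Ioo t₂ T, |a t| ≤ C * r t * (T - t) := by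
    intro t ht
    by_contra! hlt
    set δ := |a t| - C * r t * (T - t) with hδ
    have hδ0 : 0 < δ := by linarith
    have hs : ∀ u ∈ Ioo t T, u ∈ Ioo t₂ T := fun u hu => ⟨ht.1.trans hu.1, hu.2⟩
    have habs : ∀ u ∈ Ioo t T, δ ≤ |a u| := by
      intro u hu
      have h1 := (convex_Icc t u).norm_image_sub_le_of_norm_hasDerivWithin_le
        (f := a) (f' := a') (C := C * r t)
        (fun x hx => (H.hasDerivAt_a x ⟨ht.1.trans_le hx.1, hx.2.trans_lt hu.2⟩).hasDerivWithinAt)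
        (fun x hx => by
          have hx' : x ∈ Ioo t₂ T := ⟨ht.1.trans_le hx.1, hx.2.trans_lt hu.2⟩
          exact (H.abs_a'_le x hx').trans
            (mul_le_mul_of_nonneg_left (hrm ht hx' hx.1) hC))
        (left_mem_Icc.2 hu.1.le) (right_mem_Icc.2 hu.1.le)
      rw [Real.norm_eq_abs, Real.norm_eq_abs, abs_of_pos (by linarith [hu.1] : 0 < u - t)] at h1
      have h2 : C * r t * (u - t) ≤ C * r t * (T - t) := by
        have := H.r_pos t ht
        have := hu.2
        gcongr
      have h3 := abs_sub_abs_le_abs_sub (a t) (a u)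
      rw [abs_sub_comm] at h3
      linarith
    -- The barrier: `|a| ≥ δ` gives `1/r² ≤ k/δ²`, so `(log r)˙ = J/r² ≥ -(J²/r² + 1/r²)/2 ≥ -B k/2
    -- ≥ -B (J̇ + D)`. Thus `log r + B (J + D t)` increases, although `J < 0` and `log r` tends to
    -- `-∞`.
    set B := 1 + 1 / δ ^ 2 with hB
    have hB0 : 0 < B := by positivity
    have hmono : MonotoneOn (fun u => Real.log (r u) + B * (J u + D * u)) (Ioo t T) := by
      refine monotoneOn_Ioo_of_hasDerivAt (f' := fun u =>
        (J u / r u) / r u + B * ((k u - U u + R u) + D * 1)) ?_ ?_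
      · intro u hu
        exact ((H.hasDerivAt_r u (hs u hu)).log (H.r_pos u (hs u hu)).ne').add
          (((H.hasDerivAt_J u (hs u hu)).add ((hasDerivAt_id u).const_mul D)).const_mul B)
      · intro u hu
        have hrp := H.r_pos u (hs u hu)
        obtain ⟨-, -, h2⟩ := hD u (hs u hu)
        obtain ⟨h3, h4⟩ := hsun u (hs u hu)
        have h5 : δ ^ 2 / r u ^ 2 ≤ k u := by
          refine le_trans ?_ h4
          have : δ ^ 2 ≤ a u ^ 2 := by
            rw [← sq_abs (a u)]
            have := habs u hu
            gcongr
          gcongr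
        have h6 : 1 / r u ^ 2 ≤ (1 / δ ^ 2) * k u := by
          have := mul_le_mul_of_nonneg_left h5 (by positivity : 0 ≤ 1 / δ ^ 2)
          refine le_trans (le_of_eq ?_) this
          field_simp
        have h7 : -((J u / r u) / r u) ≤ (J u ^ 2 / r u ^ 2 + 1 / r u ^ 2) / 2 := by
          have : 0 ≤ (J u / r u + 1 / r u) ^ 2 := sq_nonneg _
          have e : (J u / r u + 1 / r u) ^ 2 =
            J u ^ 2 / r u ^ 2 + 1 / r u ^ 2 + 2 * ((J u / r u) / r u) := by field_simp; ring
          linarith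
        have h8 : B * (k u / 2) ≤ B * ((k u - U u + R u) + D * 1) := by
          gcongr
          linarith
        have h9 : B * (k u / 2) = k u / 2 + (1 / δ ^ 2) * k u / 2 := by rw [hB]; ring
        linarith
    have hm : (t + T) / 2 ∈ Ioo t T := ⟨by linarith [ht.2], by linarith [ht.2]⟩
    set tn := (t + T) / 2
    set L := Real.log (r tn) + B * (J tn + D * tn) - B * (D * T) with hL
    obtain ⟨t₄, ht₄, h4⟩ := (H.mono (hs _ hm)).eventually_r_lt (Real.exp_pos L)
    have hm' : (t₄ + T) / 2 ∈ Ioo t₄ T := ⟨by linarith [ht₄.2], by linarith [ht₄.2]⟩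
    set tk := (t₄ + T) / 2
    have hk : tk ∈ Ioo t T := ⟨(hm.1.trans ht₄.1).trans hm'.1, hm'.2⟩
    have h5 := hmono hm hk (ht₄.1.trans hm'.1).le
    have h6 := (Real.log_lt_iff_lt_exp (H.r_pos _ (hs _ hk))).2 (h4 _ hm')
    have h7 := (hD _ (hs _ hk)).1
    have h8 : D * tk ≤ D * T := mul_le_mul_of_nonneg_left hk.2.le hD0
    have h9 : B * (J tk + D * tk) ≤ B * (D * T) := by
      gcongr
      linarith
    simp only at h5
    linarith
  set G := J tm ^ 2 / r tm + 2 * D * r tm with hG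
  have hrtm := H.r_pos tm hm
  refine ⟨tm, ⟨ht₂.1.trans hm.1, hm.2⟩, G + (C * (T - tm)) ^ 2 + 1, by positivity, fun t ht => ?_⟩
  have hG0 : 0 ≤ G := by positivity
  have htt : t ∈ Ioo t₂ T := ⟨hm.1.trans ht.1, ht.2⟩
  have hrp := H.r_pos t htt
  refine ⟨(hD t htt).1, hlow t htt, ?_, ?_⟩
  · have h1 := hup hm htt ht.1.le
    simp only at h1
    have h2 : J t ^ 2 / r t ≤ G := by
      have : 0 ≤ 2 * D * r t := by positivity
      linarith
    have h3 := (div_le_iff₀ hrp).1 h2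
    nlinarith [sq_nonneg (C * (T - tm))]
  · have h1 := ha t htt
    have h2 : C * r t * (T - t) ≤ C * (T - tm) * r t := by
      have : C * r t * (T - t) ≤ C * r t * (T - tm) := by
        have := ht.1
        gcongr
      linarith
    have h3 : a t ^ 2 ≤ (C * (T - tm) * r t) ^ 2 := by
      rw [← sq_abs]
      exact pow_le_pow_left₀ (abs_nonneg _) (h1.trans h2) 2
    nlinarith [sq_nonneg (r t)]

end IsCollapse

/-! ### Exponential decay of the size in regularized time. -/

/-- If `r ṙ = J < 0` and `J²` is of the exact order `r`, then a time `τ` with `dτ = r^{-3/2} dt`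
tends to infinity at the collapse, and `r` decreases exponentially in `τ`. -/
theorem regularizedTime_asymptotics {r J τ : ℝ → ℝ} {t₂ T c D : ℝ} (hlt : t₂ < T)
    (hc : 0 < c) (hD : 0 < D)
    (hr : ∀ t ∈ Ioo t₂ T, 0 < r t) (hr' : ∀ t ∈ Ioo t₂ T, HasDerivAt r (J t / r t) t)
    (hJ : ∀ t ∈ Ioo t₂ T, J t < 0 ∧ c * r t ≤ J t ^ 2 ∧ J t ^ 2 ≤ D * r t)
    (hτ : ∀ t ∈ Ioo t₂ T, HasDerivAt τ (r t ^ (-(3 / 2) : ℝ)) t)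
    (hlim : Tendsto r (𝓝[<] T) (𝓝 0)) :
    Tendsto τ (𝓝[<] T) atTop ∧ ∃ t₃ ∈ Ioo t₂ T, ∃ E > 0, ∃ B > 0, ∀ t ∈ Ioo t₃ T,
      r t ≤ B * Real.exp (-E * τ t) := by
  have hm : (t₂ + T) / 2 ∈ Ioo t₂ T := ⟨by linarith, by linarith⟩
  set tm := (t₂ + T) / 2
  -- The middle quantity is `(log r)˙`, and its square is `(J²/r) r⁻³` with `J²/r` between `c` and
  -- `D`; so `log r + √c τ` decreases and `log r + √D τ` increases.
  have key : ∀ t ∈ Ioo t₂ T, J t / r t / r t ≤ -(√c * r t ^ (-(3 / 2) : ℝ)) ∧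
      -(√D * r t ^ (-(3 / 2) : ℝ)) ≤ J t / r t / r t := by
    intro t ht
    have hrp := hr t ht
    obtain ⟨h1, h2, h3⟩ := hJ t ht
    set ρ := r t ^ (-(3 / 2) : ℝ) with hρ
    have hρ0 : 0 < ρ := Real.rpow_pos_of_pos hrp _
    have hρ2 : ρ ^ 2 = (r t ^ 3)⁻¹ := by
      rw [hρ, ← Real.rpow_natCast, ← Real.rpow_mul hrp.le, ← Real.rpow_natCast (r t) 3,
        ← Real.rpow_neg hrp.le]
      norm_num
    have hJ2 : (-(J t / r t / r t)) ^ 2 = J t ^ 2 / r t * (r t ^ 3)⁻¹ := by field_simp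
    have hneg : 0 ≤ -(J t / r t / r t) := by
      have := div_nonpos_of_nonpos_of_nonneg
        (div_nonpos_of_nonpos_of_nonneg h1.le hrp.le) hrp.le
      linarith
    have h4 : c ≤ J t ^ 2 / r t := (le_div_iff₀ hrp).2 h2
    have h5 : J t ^ 2 / r t ≤ D := (div_le_iff₀ hrp).2 h3
    constructor
    · have : √c * ρ ≤ -(J t / r t / r t) := by
        refine le_of_sq_le_sq ?_ hneg
        rw [mul_pow, Real.sq_sqrt hc.le, hρ2, hJ2]
        gcongr
      linarith
    · have : -(J t / r t / r t) ≤ √D * ρ := by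
        refine le_of_sq_le_sq ?_ (by positivity)
        rw [mul_pow, Real.sq_sqrt hD.le, hρ2, hJ2]
        gcongr
      linarith
  have hlog : ∀ t ∈ Ioo t₂ T, ∀ E : ℝ, HasDerivAt (fun u => Real.log (r u) + E * τ u)
      (J t / r t / r t + E * r t ^ (-(3 / 2) : ℝ)) t := fun t ht E =>
    ((hr' t ht).log (hr t ht).ne').add ((hτ t ht).const_mul E)
  have hanti : AntitoneOn (fun u => Real.log (r u) + √c * τ u) (Ioo t₂ T) :=
    antitoneOn_Ioo_of_hasDerivAt (fun t ht => hlog t ht _) (fun t ht => by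
      have := (key t ht).1
      linarith)
  have hmono : MonotoneOn (fun u => Real.log (r u) + √D * τ u) (Ioo t₂ T) :=
    monotoneOn_Ioo_of_hasDerivAt (fun t ht => hlog t ht _) (fun t ht => by
      have := (key t ht).2
      linarith)
  have hs : ∀ t ∈ Ioo tm T, t ∈ Ioo t₂ T := fun t ht => ⟨hm.1.trans ht.1, ht.2⟩
  constructor
  · have hr0 : Tendsto r (𝓝[<] T) (𝓝[>] 0) := by
      refine tendsto_nhdsWithin_iff.2 ⟨hlim, ?_⟩
      filter_upwards [Ioo_mem_nhdsLT hlt] with t ht using hr t ht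
    have h1 : Tendsto (fun t => (√D)⁻¹ * ((Real.log (r tm) + √D * τ tm) + -Real.log (r t)))
        (𝓝[<] T) atTop :=
      (tendsto_atTop_add_const_left _ _
        (tendsto_neg_atBot_atTop.comp (Real.tendsto_log_nhdsGT_zero.comp hr0))).const_mul_atTop
          (by positivity)
    refine tendsto_atTop_mono' _ ?_ h1
    filter_upwards [Ioo_mem_nhdsLT hm.2] with t ht
    have h2 := hmono hm (hs t ht) ht.1.le
    simp only at h2
    have h3 : 0 < √D := Real.sqrt_pos.2 hD
    rw [inv_mul_le_iff₀ h3]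
    linarith
  · refine ⟨tm, hm, √c, Real.sqrt_pos.2 hc, Real.exp (Real.log (r tm) + √c * τ tm),
      Real.exp_pos _, fun t ht => ?_⟩
    have h2 := hanti hm (hs t ht) ht.1.le
    simp only at h2
    rw [← Real.exp_add, ← Real.log_le_iff_le_exp (hr t (hs t ht))]
    linarith

open scoped ComplexConjugate

/-! ### Mass-weighted relative configurations -/

theorem sum_pos_of_pos {p : ℕ} {w : Fin (p + 2) → ℝ} (hw : ∀ i, 0 < w i) : 0 < ∑ i, w i :=
  Finset.sum_pos (fun i _ => hw i) Finset.univ_nonempty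

theorem centerOfMass_add {k : ℕ} (w : Fin k → ℝ) (x y : Fin k → ℂ) :
    centerOfMass w (x + y) = centerOfMass w x + centerOfMass w y := by
  simp [centerOfMass, Finset.sum_add_distrib]

theorem centerOfMass_smul {k : ℕ} (w : Fin k → ℝ) (a : ℂ) (x : Fin k → ℂ) :
    centerOfMass w (a • x) = a * centerOfMass w x := by
  simp only [centerOfMass, Finset.mul_sum, Pi.smul_apply, smul_eq_mul, Complex.real_smul]
  exact Finset.sum_congr rfl fun i _ => by ring

theorem sum_mul_sub_centerOfMass {p : ℕ} {w : Fin (p + 2) → ℝ} (hw : ∀ i, 0 < w i)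
    (x : Fin (p + 2) → ℂ) : ∑ i, (w i : ℂ) * (x i - centerOfMass w x) = 0 := by
  have hW : ((∑ i, w i : ℝ) : ℂ) ≠ 0 := by exact_mod_cast (sum_pos_of_pos hw).ne'
  simp only [mul_sub, Finset.sum_sub_distrib, ← Finset.sum_mul]
  rw [centerOfMass, Complex.real_smul, Complex.ofReal_inv, ← Complex.ofReal_sum,
    mul_inv_cancel_left₀ hW]
  simp [Complex.real_smul]

/-- The configuration relative to the centre of mass, weighted by the square roots of the masses,
so that the Euclidean norm is the size. -/
def relMap {k : ℕ} (w : Fin k → ℝ) : (Fin k → ℂ) →L[ℂ] EuclideanSpace ℂ (Fin k) :=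
  LinearMap.toContinuousLinearMap
    { toFun := fun x => WithLp.toLp 2 fun i => (√(w i) : ℂ) * (x i - centerOfMass w x)
      map_add' := fun x y => by
        ext i
        simp only [centerOfMass_add, Pi.add_apply, PiLp.add_apply]
        ring
      map_smul' := fun a x => by
        ext i
        simp only [centerOfMass_smul, Pi.smul_apply, PiLp.smul_apply, smul_eq_mul,
          RingHom.id_apply]
        ring }

theorem relMap_apply {k : ℕ} (w : Fin k → ℝ) (x : Fin k → ℂ) (i : Fin k) :
    relMap w x i = (√(w i) : ℂ) * (x i - centerOfMass w x) := rfl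

theorem norm_relMap {k : ℕ} {w : Fin k → ℝ} (hw : ∀ i, 0 < w i) (x : Fin k → ℂ) :
    ‖relMap w x‖ = size w x := by
  rw [EuclideanSpace.norm_eq, size]
  congr 1
  refine Finset.sum_congr rfl fun i _ => ?_
  rw [relMap_apply, norm_mul, mul_pow, Complex.norm_real, Real.norm_eq_abs,
    abs_of_nonneg (Real.sqrt_nonneg _), Real.sq_sqrt (hw i).le]

/-- The weighted positions relative to the centre sum to zero, so only one factor needs centring;
forces can then be inserted for `y` as they are. -/
theorem inner_relMap {p : ℕ} {w : Fin (p + 2) → ℝ} (hw : ∀ i, 0 < w i) (x y : Fin (p + 2) → ℂ) :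
    inner ℂ (relMap w x) (relMap w y) = ∑ i, (w i : ℂ) * (conj (x i - centerOfMass w x) * y i) := by
  have h0 : ∑ i, (w i : ℂ) * conj (x i - centerOfMass w x) = 0 := by
    have := congrArg conj (sum_mul_sub_centerOfMass hw x)
    simpa [map_sum, map_mul] using this
  have h1 : ∑ i, (w i : ℂ) * (conj (x i - centerOfMass w x) * centerOfMass w y) = 0 := by
    simp only [← mul_assoc, ← Finset.sum_mul, h0, zero_mul]
  rw [PiLp.inner_apply, ← sub_zero (∑ i, _ * (_ * y i)), ← h1, ← Finset.sum_sub_distrib]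
  refine Finset.sum_congr rfl fun i _ => ?_
  have h2 : (√(w i) : ℂ) * √(w i) = w i := by
    exact_mod_cast Real.mul_self_sqrt (hw i).le
  rw [relMap_apply, relMap_apply, RCLike.inner_apply, map_mul, Complex.conj_ofReal, ← h2]
  ring

theorem norm_sub_centerOfMass_le {k : ℕ} {w : Fin k → ℝ} (hw : ∀ i, 0 < w i) (x : Fin k → ℂ)
    (i : Fin k) : ‖x i - centerOfMass w x‖ ≤ (√(w i))⁻¹ * size w x := by
  have h : 0 < √(w i) := Real.sqrt_pos.2 (hw i)
  have := PiLp.norm_apply_le (relMap w x) i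
  rw [relMap_apply, norm_mul, Complex.norm_real, Real.norm_eq_abs, abs_of_pos h,
    norm_relMap hw] at this
  rw [inv_mul_eq_div, le_div_iff₀ h]
  linarith

/-! ### Internal forces and the internal potential -/

/-- Acceleration of the `i`-th body due to the other bodies of the configuration. -/
def internalAcc {k : ℕ} (w : Fin k → ℝ) (x : Fin k → ℂ) (i : Fin k) : ℂ :=
  ∑ j, (w j / ‖x j - x i‖ ^ 3) • (x j - x i)

/-- The Newtonian potential of a configuration, as half of a sum over ordered pairs. -/
def internalPotential {k : ℕ} (w : Fin k → ℝ) (x : Fin k → ℂ) : ℝ :=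
  ∑ i, ∑ j, w i * w j / 2 * ‖x j - x i‖⁻¹

/-- Action equals reaction: averaging over the exchange of `i` and `j` leaves only differences of
`u`, so `c` drops out. -/
theorem sum_mul_internalAcc {k : ℕ} (w : Fin k → ℝ) (x u : Fin k → ℂ) (c : ℂ) :
    ∑ i, (w i : ℂ) * (conj (u i - c) * internalAcc w x i) =
      ∑ i, ∑ j, ((w i * w j / 2 / ‖x j - x i‖ ^ 3 : ℝ) : ℂ)
        * (conj (u i - u j) * (x j - x i)) := by
  set S : Fin k → Fin k → ℂ := fun i j =>
    ((w i * w j / ‖x j - x i‖ ^ 3 : ℝ) : ℂ) * (conj (u i - c) * (x j - x i)) with hS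
  have h1 : ∑ i, (w i : ℂ) * (conj (u i - c) * internalAcc w x i) = ∑ i, ∑ j, S i j := by
    refine Finset.sum_congr rfl fun i _ => ?_
    rw [internalAcc, Finset.mul_sum, Finset.mul_sum]
    refine Finset.sum_congr rfl fun j _ => ?_
    rw [hS, Complex.real_smul]
    push_cast
    ring
  have h2 : ∑ i, ∑ j, S i j = ∑ i, ∑ j, (S i j + S j i) / 2 := by
    have h3 : ∑ i, ∑ j, S j i = ∑ i, ∑ j, S i j := Finset.sum_comm
    simp only [add_div, Finset.sum_add_distrib, ← Finset.sum_div]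
    rw [h3]
    ring
  rw [h1, h2]
  refine Finset.sum_congr rfl fun i _ => Finset.sum_congr rfl fun j _ => ?_
  simp only [hS, norm_sub_rev (x i) (x j), map_sub]
  push_cast
  ring

/-- Euler's identity for a potential homogeneous of degree `-1`. That the complex sum is real says
that internal forces exert no torque. -/
theorem sum_mul_internalAcc_self {k : ℕ} (w : Fin k → ℝ) (x : Fin k → ℂ) (c : ℂ) :
    ∑ i, (w i : ℂ) * (conj (x i - c) * internalAcc w x i) = -(internalPotential w x : ℂ) := by
  rw [sum_mul_internalAcc, internalPotential]
  push_cast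
  simp only [← Finset.sum_neg_distrib]
  refine Finset.sum_congr rfl fun i _ => Finset.sum_congr rfl fun j _ => ?_
  have h1 : conj (x i - x j) * (x j - x i) = -((‖x j - x i‖ ^ 2 : ℝ) : ℂ) := by
    have := Complex.conj_mul' (x j - x i)
    push_cast
    rw [← this, ← neg_sub (x j) (x i), map_neg]
    ring
  rw [h1]
  -- The diagonal terms contribute zero on both sides, as `0⁻¹ = 0`.
  by_cases h : x j - x i = 0
  · simp [h]
  · have h2 : (‖x j - x i‖ : ℂ) ≠ 0 := by exact_mod_cast norm_ne_zero_iff.2 h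
    push_cast
    field_simp

theorem hasDerivAt_norm_inv {f : ℝ → ℂ} {f' : ℂ} {t : ℝ} (hf : HasDerivAt f f' t) (h0 : f t ≠ 0) :
    HasDerivAt (fun u => ‖f u‖⁻¹) (-(conj f' * f t).re / ‖f t‖ ^ 3) t := by
  have h1 : HasDerivAt (fun u => ‖f u‖ ^ 2) (2 * (conj f' * f t).re) t := by
    refine hf.norm_sq.congr_deriv ?_
    rw [Complex.inner]
    simp only [Complex.mul_re, Complex.conj_re, Complex.conj_im]
    ring
  have hn : 0 < ‖f t‖ := norm_pos_iff.2 h0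
  have h2 := h1.sqrt (by positivity)
  have h3 : (fun u => √(‖f u‖ ^ 2)) = fun u => ‖f u‖ := by
    ext u
    exact Real.sqrt_sq (norm_nonneg _)
  rw [h3, Real.sqrt_sq hn.le] at h2
  refine (h2.inv hn.ne').congr_deriv ?_
  field_simp

/-- The constant `c` is free because internal forces balance; taken as the velocity of the centre of
mass, it gives the expression of `inner_relMap`. -/
theorem hasDerivAt_internalPotential {k : ℕ} (w : Fin k → ℝ) {x : ℝ → Fin k → ℂ}
    {y : Fin k → ℂ} {t : ℝ} (hx : ∀ i, HasDerivAt (fun u => x u i) (y i) t)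
    (h0 : ∀ i j, i ≠ j → x t i ≠ x t j) (c : ℂ) :
    HasDerivAt (fun u => internalPotential w (x u))
      (∑ i, (w i : ℂ) * (conj (y i - c) * internalAcc w (x t) i)).re t := by
  rw [sum_mul_internalAcc, Complex.re_sum]
  refine HasDerivAt.fun_sum fun i _ => ?_
  rw [Complex.re_sum]
  refine HasDerivAt.fun_sum fun j _ => ?_
  by_cases hij : j = i
  · subst hij
    simpa using hasDerivAt_const t (0 : ℝ)
  · refine ((hasDerivAt_norm_inv ((hx j).fun_sub (hx i)) (sub_ne_zero.2 (h0 j i hij))).const_mul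
      (w i * w j / 2)).congr_deriv ?_
    rw [Complex.re_ofReal_mul, ← neg_sub (y j) (y i), map_neg, neg_mul, Complex.neg_re]
    ring

/-- A single pair suffices: its mutual distance is at most a multiple of the size. This supplies the
constant `c` of `IsCollapse`. -/
theorem le_internalPotential {p : ℕ} {w : Fin (p + 2) → ℝ} (hw : ∀ i, 0 < w i)
    {x : Fin (p + 2) → ℂ} (h0 : ∀ i j, i ≠ j → x i ≠ x j) :
    w 0 * w 1 / 2 / ((√(w 0))⁻¹ + (√(w 1))⁻¹) / size w x ≤ internalPotential w x := by
  have h01 : (1 : Fin (p + 2)) ≠ 0 := by simp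
  have hpos : 0 < ‖x 1 - x 0‖ := norm_pos_iff.2 (sub_ne_zero.2 (h0 _ _ h01))
  have h1 : w 0 * w 1 / 2 * ‖x 1 - x 0‖⁻¹ ≤ internalPotential w x := by
    have hn : ∀ i j, 0 ≤ w i * w j / 2 * ‖x j - x i‖⁻¹ := fun i j => by
      have := hw i
      have := hw j
      positivity
    refine le_trans ?_ (Finset.single_le_sum (f := fun i => ∑ j, w i * w j / 2 * ‖x j - x i‖⁻¹)
      (fun i _ => Finset.sum_nonneg fun j _ => hn i j) (Finset.mem_univ 0))
    exact Finset.single_le_sum (f := fun j => w 0 * w j / 2 * ‖x j - x 0‖⁻¹)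
      (fun j _ => hn 0 j) (Finset.mem_univ 1)
  refine le_trans ?_ h1
  have h2 : ‖x 1 - x 0‖ ≤ ((√(w 0))⁻¹ + (√(w 1))⁻¹) * size w x := by
    have := norm_sub_le (x 1 - centerOfMass w x) (x 0 - centerOfMass w x)
    rw [sub_sub_sub_cancel_right] at this
    linarith [norm_sub_centerOfMass_le hw x 0, norm_sub_centerOfMass_le hw x 1]
  rw [div_div, div_eq_mul_inv]
  have := hw 0
  have := hw 1
  gcongr

/-! ### The cluster as a perturbed collapsing system -/

section Cluster

variable {n p : ℕ} {m : Fin n → ℝ} {q v : ℝ → Fin n → ℂ} {t₀ T : ℝ} {e : Fin (p + 2) ↪ Fin n}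

open Classical in
/-- Acceleration of the `i`-th body of the cluster due to the bodies outside the cluster. -/
def externalAcc (m : Fin n → ℝ) (e : Fin (p + 2) ↪ Fin n) (Q : Fin n → ℂ) (i : Fin (p + 2)) : ℂ :=
  ∑ j ∈ Finset.univ.filter (fun j => j ∉ range e), (m j / ‖Q j - Q (e i)‖ ^ 3) • (Q j - Q (e i))

theorem acceleration_eq (m : Fin n → ℝ) (e : Fin (p + 2) ↪ Fin n) (Q : Fin n → ℂ)
    (i : Fin (p + 2)) :
    ∑ j ∈ Finset.univ.erase (e i), (m j / ‖Q j - Q (e i)‖ ^ 3) • (Q j - Q (e i)) =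
      internalAcc (m ∘ e) (fun i => Q (e i)) i + externalAcc m e Q i := by
  classical
  rw [Finset.sum_erase _ (by simp), externalAcc, internalAcc,
    ← Finset.sum_filter_add_sum_filter_not Finset.univ (fun j => j ∈ range e)]
  congr 1
  have : Finset.univ.filter (fun j => j ∈ range e) = Finset.univ.map e := by
    ext j
    simp
  rw [this, Finset.sum_map]
  rfl

theorem IsOrbit.hasDerivAt_position (hq : IsOrbit m q v t₀ T) {t : ℝ} (ht : t ∈ Ioo t₀ T)
    (i : Fin n) : HasDerivAt (fun u => q u i) (v t i) t :=
  (hq.velocity t ⟨ht.1.le, ht.2⟩ i).hasDerivAt (Ico_mem_nhds ht.1 ht.2)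

theorem IsOrbit.hasDerivAt_velocity (hq : IsOrbit m q v t₀ T) {t : ℝ} (ht : t ∈ Ioo t₀ T)
    (i : Fin (p + 2)) : HasDerivAt (fun u => cluster e v u i)
      (internalAcc (m ∘ e) (cluster e q t) i + externalAcc m e (q t) i) t :=
  ((hq.newton t ⟨ht.1.le, ht.2⟩ (e i)).hasDerivAt (Ico_mem_nhds ht.1 ht.2)).congr_deriv
    (acceleration_eq m e (q t) i)

theorem _root_.HasDerivAt.clm_apply_const {E F : Type*} [NormedAddCommGroup E] [NormedSpace ℂ E]
    [NormedAddCommGroup F] [NormedSpace ℂ F] (L : E →L[ℂ] F) {f : ℝ → E} {f' : E} {t : ℝ}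
    (hf : HasDerivAt f f' t) : HasDerivAt (fun u => L (f u)) (L f') t :=
  (L.restrictScalars ℝ).hasFDerivAt.comp_hasDerivAt t hf

theorem _root_.HasDerivAt.complex_re {f : ℝ → ℂ} {f' : ℂ} {t : ℝ} (hf : HasDerivAt f f' t) :
    HasDerivAt (fun u => (f u).re) f'.re t :=
  Complex.reCLM.hasFDerivAt.comp_hasDerivAt t hf

theorem _root_.HasDerivAt.complex_im {f : ℝ → ℂ} {f' : ℂ} {t : ℝ} (hf : HasDerivAt f f' t) :
    HasDerivAt (fun u => (f u).im) f'.im t :=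
  Complex.imCLM.hasFDerivAt.comp_hasDerivAt t hf

/-- The Hermitian product of the relative position and the relative velocity of the cluster:
its real part is `r ṙ`, its imaginary part the intrinsic angular momentum. -/
def posVel (m : Fin n → ℝ) (e : Fin (p + 2) ↪ Fin n) (q v : ℝ → Fin n → ℂ) (t : ℝ) : ℂ :=
  inner ℂ (relMap (m ∘ e) (cluster e q t)) (relMap (m ∘ e) (cluster e v t))

theorem hasDerivAt_relMap_cluster (hq : IsOrbit m q v t₀ T) {t : ℝ} (ht : t ∈ Ioo t₀ T) :
    HasDerivAt (fun u => relMap (m ∘ e) (cluster e q u)) (relMap (m ∘ e) (cluster e v t)) t :=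
  (hasDerivAt_pi.2 fun i => hq.hasDerivAt_position ht (e i)).clm_apply_const _

theorem hasDerivAt_relMap_velocity (hq : IsOrbit m q v t₀ T) {t : ℝ} (ht : t ∈ Ioo t₀ T) :
    HasDerivAt (fun u => relMap (m ∘ e) (cluster e v u))
      (relMap (m ∘ e) (internalAcc (m ∘ e) (cluster e q t)) +
        relMap (m ∘ e) (externalAcc m e (q t))) t := by
  rw [← map_add]
  exact (hasDerivAt_pi.2 fun i => hq.hasDerivAt_velocity ht i).clm_apply_const _

theorem hasDerivAt_normSq {k : ℕ} {X : ℝ → EuclideanSpace ℂ (Fin k)}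
    {V : EuclideanSpace ℂ (Fin k)} {t : ℝ} (hX : HasDerivAt X V t) :
    HasDerivAt (fun u => ‖X u‖ ^ 2) (2 * (inner ℂ (X t) V).re) t := by
  have h1 := (hX.inner ℂ hX).complex_re
  have h2 : (fun u => (inner ℂ (X u) (X u)).re) = fun u => ‖X u‖ ^ 2 := by
    ext u
    rw [inner_self_eq_norm_sq_to_K]
    norm_cast
  rw [h2] at h1
  refine h1.congr_deriv ?_
  rw [Complex.add_re, ← inner_conj_symm V (X t), Complex.conj_re]
  ring

theorem size_cluster_pos (hm : ∀ i, 0 < m i) (hq : IsOrbit m q v t₀ T) {t : ℝ}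
    (ht : t ∈ Ico t₀ T) : 0 < rr m e q t := by
  have hw : ∀ i, 0 < (m ∘ e) i := fun i => hm _
  have h0 : 0 ≤ rr m e q t := Real.sqrt_nonneg _
  refine lt_of_le_of_ne h0 fun h => ?_
  have hc : ∀ i, cluster e q t i = centerOfMass (m ∘ e) (cluster e q t) := fun i => by
    have := norm_sub_centerOfMass_le hw (cluster e q t) i
    rw [show size (m ∘ e) (cluster e q t) = 0 from h.symm, mul_zero, norm_le_zero_iff,
      sub_eq_zero] at this
    exact this
  have h01 : (1 : Fin (p + 2)) ≠ 0 := by simp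
  exact hq.noncollision t ht (e 1) (e 0) (fun h => h01 (e.injective h))
    ((hc 1).trans (hc 0).symm)

theorem hasDerivAt_rr (hm : ∀ i, 0 < m i) (hq : IsOrbit m q v t₀ T) {t : ℝ}
    (ht : t ∈ Ioo t₀ T) :
    HasDerivAt (rr m e q) ((posVel m e q v t).re / rr m e q t) t := by
  have hw : ∀ i, 0 < (m ∘ e) i := fun i => hm _
  have hpos : 0 < rr m e q t := size_cluster_pos hm hq ⟨ht.1.le, ht.2⟩
  have hr : ∀ u, ‖relMap (m ∘ e) (cluster e q u)‖ = rr m e q u := fun u => norm_relMap hw _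
  have h1 := hasDerivAt_normSq (hasDerivAt_relMap_cluster (e := e) hq ht)
  simp only [hr] at h1
  have h2 := h1.sqrt (by positivity)
  have h3 : (fun u => √(rr m e q u ^ 2)) = rr m e q := by
    ext u
    exact Real.sqrt_sq (Real.sqrt_nonneg _)
  rw [h3, Real.sqrt_sq hpos.le] at h2
  exact h2.congr_deriv (mul_div_mul_left _ _ two_ne_zero)

theorem inner_relMap_internalAcc (hm : ∀ i, 0 < m i) (x : Fin (p + 2) → ℂ) :
    inner ℂ (relMap (m ∘ e) x) (relMap (m ∘ e) (internalAcc (m ∘ e) x)) =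
      -(internalPotential (m ∘ e) x : ℂ) := by
  rw [inner_relMap (w := m ∘ e) (fun i => hm _), sum_mul_internalAcc_self]

/-- The real part is the Lagrange–Jacobi identity; in the imaginary part only the external torque
survives. -/
theorem hasDerivAt_posVel (hm : ∀ i, 0 < m i) (hq : IsOrbit m q v t₀ T) {t : ℝ}
    (ht : t ∈ Ioo t₀ T) :
    HasDerivAt (posVel m e q v) (((‖relMap (m ∘ e) (cluster e v t)‖ ^ 2
      - internalPotential (m ∘ e) (cluster e q t) : ℝ) : ℂ)
      + inner ℂ (relMap (m ∘ e) (cluster e q t)) (relMap (m ∘ e) (externalAcc m e (q t)))) t := by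
  refine ((hasDerivAt_relMap_cluster hq ht).inner ℂ
    (hasDerivAt_relMap_velocity hq ht)).congr_deriv ?_
  rw [inner_add_right, inner_relMap_internalAcc hm, inner_self_eq_norm_sq_to_K]
  push_cast
  simp only [Complex.coe_algebraMap]
  ring

/-- The power of the internal forces cancels against the change of the potential, leaving that of
the external forces. -/
theorem hasDerivAt_energy (hm : ∀ i, 0 < m i) (hq : IsOrbit m q v t₀ T) {t : ℝ}
    (ht : t ∈ Ioo t₀ T) :
    HasDerivAt (fun u => ‖relMap (m ∘ e) (cluster e v u)‖ ^ 2 / 2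
      - internalPotential (m ∘ e) (cluster e q u))
      (inner ℂ (relMap (m ∘ e) (cluster e v t))
        (relMap (m ∘ e) (externalAcc m e (q t)))).re t := by
  have hw : ∀ i, 0 < (m ∘ e) i := fun i => hm _
  have h1 := (hasDerivAt_normSq (hasDerivAt_relMap_velocity (e := e) hq ht)).div_const 2
  have h2 := hasDerivAt_internalPotential (m ∘ e) (x := cluster e q) (t := t)
    (fun i => hq.hasDerivAt_position ht (e i))
    (fun i j hij => hq.noncollision t ⟨ht.1.le, ht.2⟩ _ _ fun h => hij (e.injective h))
    (centerOfMass (m ∘ e) (cluster e v t))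
  refine (h1.sub h2).congr_deriv ?_
  rw [inner_add_right, Complex.add_re, inner_relMap hw (cluster e v t) (internalAcc _ _)]
  simp only [cluster]
  ring

/-- The forces exerted on the cluster by the other bodies are bounded near the collision. -/
theorem externalAcc_bounded (hcol : IsPartialCollision q T e) :
    ∃ B, ∀ᶠ t in 𝓝[<] T, ‖relMap (m ∘ e) (externalAcc m e (q t))‖ ≤ B := by
  classical
  obtain ⟨L, hL, hcl⟩ := hcol.exists_limit
  have h1 : ∀ i, Tendsto (fun t => externalAcc m e (q t) i) (𝓝[<] T)
      (𝓝 (externalAcc m e L i)) := by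
    intro i
    refine tendsto_finsetSum _ fun j hj => ?_
    have hj' : j ∉ range e := (Finset.mem_filter.1 hj).2
    have hne : L j - L (e i) ≠ 0 := by
      rw [sub_ne_zero]
      intro h
      exact hj' ((hcl j).2 (h.trans ((hcl (e i)).1 ⟨i, rfl⟩)))
    have h2 := (hL j).sub (hL (e i))
    exact (Tendsto.div tendsto_const_nhds (h2.norm.pow 3)
      (pow_ne_zero _ (norm_ne_zero_iff.2 hne))).smul h2
  have h3 := (((relMap (m ∘ e)).continuous.tendsto _).comp (tendsto_pi_nhds.2 h1)).norm
  exact ⟨_, (h3.eventually (gt_mem_nhds (lt_add_one _))).mono fun t ht => le_of_lt ht⟩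

theorem tendsto_centerOfMass {k : ℕ} (w : Fin k → ℝ) (hW : ∑ i, w i ≠ 0) {l : Filter ℝ}
    {x : ℝ → Fin k → ℂ} {L : ℂ} (hx : ∀ i, Tendsto (fun t => x t i) l (𝓝 L)) :
    Tendsto (fun t => centerOfMass w (x t)) l (𝓝 L) := by
  have h : Tendsto (fun t => centerOfMass w (x t)) l (𝓝 ((∑ i, w i)⁻¹ • ∑ i, w i • L)) :=
    (tendsto_finsetSum _ fun i _ => (hx i).const_smul (w i)).const_smul _
  rwa [← Finset.sum_smul, inv_smul_smul₀ hW] at h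

theorem tendsto_cc (hm : ∀ i, 0 < m i) {L : Fin n → ℂ}
    (hL : ∀ i, Tendsto (fun t => q t i) (𝓝[<] T) (𝓝 (L i)))
    (hcl : ∀ i, i ∈ range e ↔ L i = L (e 0)) :
    Tendsto (cc m e q) (𝓝[<] T) (𝓝 (L (e 0))) :=
  tendsto_centerOfMass (m ∘ e) (sum_pos_of_pos fun i => hm _).ne' fun i => by
    rw [← (hcl (e i)).1 ⟨i, rfl⟩]
    exact hL (e i)

theorem tendsto_rr (hm : ∀ i, 0 < m i) (hcol : IsPartialCollision q T e) :
    Tendsto (rr m e q) (𝓝[<] T) (𝓝 0) := by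
  obtain ⟨L, hL, hcl⟩ := hcol.exists_limit
  have hc := tendsto_cc hm hL hcl
  have h : Tendsto (fun t => ∑ i, (m ∘ e) i *
      ‖cluster e q t i - centerOfMass (m ∘ e) (cluster e q t)‖ ^ 2) (𝓝[<] T) (𝓝 0) := by
    rw [← Finset.sum_const_zero (s := (Finset.univ : Finset (Fin (p + 2))))]
    refine tendsto_finsetSum _ fun i _ => ?_
    have h1 := hL (e i)
    rw [(hcl (e i)).1 ⟨i, rfl⟩] at h1
    have h2 := ((h1.sub hc).norm.pow 2).const_mul ((m ∘ e) i)
    rwa [sub_self, norm_zero, zero_pow two_ne_zero, mul_zero] at h2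
  have h3 := (Real.continuous_sqrt.tendsto 0).comp h
  rwa [Real.sqrt_zero] at h3

/-- A cluster of a partial collision is a perturbed collapsing system. -/
theorem exists_isCollapse (hm : ∀ i, 0 < m i) (ht : t₀ < T) (hq : IsOrbit m q v t₀ T)
    (hcol : IsPartialCollision q T e) : ∃ t₁ ∈ Ioo t₀ T, ∃ C c,
      IsCollapse (rr m e q) (fun t => (posVel m e q v t).re)
        (fun t => ‖relMap (m ∘ e) (cluster e v t)‖ ^ 2)
        (fun t => internalPotential (m ∘ e) (cluster e q t))
        (fun t => (inner ℂ (relMap (m ∘ e) (cluster e q t))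
          (relMap (m ∘ e) (externalAcc m e (q t)))).re)
        (fun t => (inner ℂ (relMap (m ∘ e) (cluster e v t))
          (relMap (m ∘ e) (externalAcc m e (q t)))).re)
        (fun t => (posVel m e q v t).im)
        (fun t => (inner ℂ (relMap (m ∘ e) (cluster e q t))
          (relMap (m ∘ e) (externalAcc m e (q t)))).im) t₁ T C c := by
  have hw : ∀ i, 0 < (m ∘ e) i := fun i => hm _
  obtain ⟨B, hB⟩ := externalAcc_bounded (m := m) hcol
  have hr1 := (tendsto_rr hm hcol).eventually (gt_mem_nhds one_pos)
  obtain ⟨t₁, ht₁, h1⟩ := exists_Ioo_of_eventually ht (hB.and hr1)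
  have hs : ∀ t ∈ Ioo t₁ T, t ∈ Ioo t₀ T := fun t h => ⟨ht₁.1.trans h.1, h.2⟩
  have hr : ∀ u, ‖relMap (m ∘ e) (cluster e q u)‖ = rr m e q u := fun u => norm_relMap hw _
  have hB0 : 0 ≤ B := by
    have h : (t₁ + T) / 2 ∈ Ioo t₁ T := ⟨by linarith [ht₁.2], by linarith [ht₁.2]⟩
    exact (norm_nonneg _).trans (h1 _ h).1
  have hrem : ∀ t ∈ Ioo t₁ T, ‖inner ℂ (relMap (m ∘ e) (cluster e q t))
      (relMap (m ∘ e) (externalAcc m e (q t)))‖ ≤ rr m e q t * B := fun t h => by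
    refine (norm_inner_le_norm _ _).trans ?_
    rw [hr]
    exact mul_le_mul_of_nonneg_left (h1 t h).1 (Real.sqrt_nonneg _)
  have hpos : ∀ t ∈ Ioo t₁ T, 0 < rr m e q t := fun t h =>
    size_cluster_pos hm hq ⟨(hs t h).1.le, h.2⟩
  -- `B` bounds the virial and torque terms, which are at most `r B` with `r < 1`; `B²` comes from
  -- splitting the external power, at most `√k B`, into `k/2 + B²/2`.
  refine ⟨t₁, ht₁, B + B ^ 2, (m ∘ e) 0 * (m ∘ e) 1 / 2 / ((√((m ∘ e) 0))⁻¹ + (√((m ∘ e) 1))⁻¹),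
    ht₁.2, ?_, hpos, fun t h => hasDerivAt_rr hm hq (hs t h), ?_,
    fun t h => hasDerivAt_energy hm hq (hs t h), ?_, ?_, ?_, ?_, ?_, ?_, tendsto_rr hm hcol⟩
  · have := hw 0
    have := hw 1
    positivity
  · intro t h
    refine (hasDerivAt_posVel hm hq (hs t h)).complex_re.congr_deriv ?_
    rw [Complex.add_re, Complex.ofReal_re]
  · intro t h
    have h2 := (abs_le.1 ((Complex.abs_re_le_norm _).trans (norm_inner_le_norm (𝕜 := ℂ)
      (relMap (m ∘ e) (cluster e v t)) (relMap (m ∘ e) (externalAcc m e (q t)))))).1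
    have h3 := (h1 t h).1
    have h4 := norm_nonneg (relMap (m ∘ e) (externalAcc m e (q t)))
    nlinarith [sq_nonneg (‖relMap (m ∘ e) (cluster e v t)‖
      - ‖relMap (m ∘ e) (externalAcc m e (q t))‖)]
  · intro t h
    refine (Complex.abs_re_le_norm _).trans ((hrem t h).trans ?_)
    have := (h1 t h).2
    nlinarith
  · intro t h
    exact le_internalPotential hw fun i j hij =>
      hq.noncollision t ⟨(hs t h).1.le, h.2⟩ _ _ fun h => hij (e.injective h)
  · intro t h
    refine (hasDerivAt_posVel hm hq (hs t h)).complex_im.congr_deriv ?_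
    rw [Complex.add_im, Complex.ofReal_im, zero_add]
  · intro t h
    refine (Complex.abs_im_le_norm _).trans ((hrem t h).trans ?_)
    have := hpos t h
    nlinarith [mul_nonneg (sq_nonneg B) this.le]
  · intro t h
    have h2 : ‖posVel m e q v t‖ ≤ rr m e q t * ‖relMap (m ∘ e) (cluster e v t)‖ := by
      rw [← hr]
      exact norm_inner_le_norm _ _
    have h3 := pow_le_pow_left₀ (norm_nonneg _) h2 2
    rw [← Complex.normSq_eq_norm_sq, Complex.normSq_apply, mul_pow] at h3
    linarith

end Cluster

/-! ### Jacobi coordinates as an isometric chart of the relative configurations -/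

section Jacobi

variable {p : ℕ} {w : Fin (p + 2) → ℝ} {P : Matrix (Fin (p + 2)) (Fin (p + 2)) ℂ}

/-- The mass-weighted relative configuration with relative Jacobi coordinates `u`. -/
def jac (w : Fin (p + 2) → ℝ) (P : Matrix (Fin (p + 2)) (Fin (p + 2)) ℂ) :
    (Fin (p + 1) → ℂ) →L[ℂ] EuclideanSpace ℂ (Fin (p + 2)) :=
  LinearMap.toContinuousLinearMap
    { toFun := fun u => relMap w (P.mulVec (Fin.snoc (α := fun _ => ℂ) u 0))
      map_add' := fun u u' => by
        rw [← map_add, ← Matrix.mulVec_add]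
        congr 2
        ext i
        refine Fin.lastCases ?_ (fun j => ?_) i <;> simp
      map_smul' := fun a u => by
        rw [RingHom.id_apply, ← map_smul, ← Matrix.mulVec_smul]
        congr 2
        ext i
        refine Fin.lastCases ?_ (fun j => ?_) i <;> simp }

theorem jac_apply (u : Fin (p + 1) → ℂ) :
    jac w P u = relMap w (P.mulVec (Fin.snoc (α := fun _ => ℂ) u 0)) := rfl

theorem centerOfMass_mulVec_snoc (hP : IsJacobi w P) (u : Fin (p + 1) → ℂ) (c : ℂ) :
    centerOfMass w (P.mulVec (Fin.snoc (α := fun _ => ℂ) u c)) = c := by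
  rw [← hP.last_eq, Fin.snoc_last]

/-- A zero last coordinate means a centre of mass at the origin, and it also annihilates the deleted
row and column of the mass matrix. -/
theorem inner_jac (hw : ∀ i, 0 < w i) (hP : IsJacobi w P) (u u' : Fin (p + 1) → ℂ) :
    inner ℂ (jac w P u) (jac w P u') = herm (relMass w P) u u' := by
  set a : Fin (p + 2) → ℂ := Fin.snoc (α := fun _ => ℂ) u 0 with ha
  set b : Fin (p + 2) → ℂ := Fin.snoc (α := fun _ => ℂ) u' 0 with hb
  have h1 : herm (relMass w P) u u' =
      star a ⬝ᵥ (P.conjTranspose * Matrix.diagonal (fun i => (w i : ℂ)) * P).mulVec b := by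
    simp only [herm, relMass, dotProduct, Matrix.mulVec, Fin.sum_univ_castSucc (n := p + 1),
      ha, hb, Pi.star_apply, Fin.snoc_castSucc, Fin.snoc_last, mul_zero, add_zero, star_zero,
      zero_mul, Matrix.submatrix_apply]
  rw [h1, ← Matrix.mulVec_mulVec, ← Matrix.mulVec_mulVec, Matrix.dotProduct_mulVec,
    ← Matrix.star_mulVec, jac_apply, jac_apply, inner_relMap hw, centerOfMass_mulVec_snoc hP]
  simp only [dotProduct, Matrix.mulVec_diagonal, sub_zero, Pi.star_apply, RCLike.star_def]
  exact Finset.sum_congr rfl fun i _ => by ring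

theorem jac_eq_zero (hw : ∀ i, 0 < w i) (hP : IsJacobi w P) {u : Fin (p + 1) → ℂ}
    (h : jac w P u = 0) : u = 0 := by
  have h1 : P.mulVec (Fin.snoc (α := fun _ => ℂ) u 0) = 0 := by
    ext i
    have := congrArg (fun x : EuclideanSpace ℂ (Fin (p + 2)) => x i) h
    simp only [jac_apply, relMap_apply, centerOfMass_mulVec_snoc hP, sub_zero,
      PiLp.zero_apply, mul_eq_zero, Complex.ofReal_eq_zero] at this
    exact this.resolve_left (Real.sqrt_pos.2 (hw i)).ne'
  have h2 : (Fin.snoc (α := fun _ => ℂ) u 0 : Fin (p + 2) → ℂ) = 0 := by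
    have := congrArg P⁻¹.mulVec h1
    rwa [Matrix.mulVec_mulVec, Matrix.nonsing_inv_mul _ hP.isUnit_det, Matrix.one_mulVec,
      Matrix.mulVec_zero] at this
  ext j
  have := congrFun h2 j.castSucc
  simpa using this

theorem jac_injective (hw : ∀ i, 0 < w i) (hP : IsJacobi w P) : Function.Injective (jac w P) :=
  (injective_iff_map_eq_zero _).2 fun _ h => jac_eq_zero hw hP h

theorem exists_norm_le_jac (hw : ∀ i, 0 < w i) (hP : IsJacobi w P) :
    ∃ K > 0, ∀ u, ‖u‖ ≤ K * ‖jac w P u‖ := by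
  have hk : LinearMap.ker (jac w P).toLinearMap = ⊥ :=
    LinearMap.ker_eq_bot.2 (by exact jac_injective hw hP)
  obtain ⟨K, hK, h⟩ := LinearMap.exists_antilipschitzWith _ hk
  refine ⟨K, hK, fun u => ?_⟩
  have := h.le_mul_dist u 0
  simpa using this

/-- König's decomposition of the moment of inertia; the mixed terms vanish. -/
theorem norm_sq_eq_relMap_add (hw : ∀ i, 0 < w i) (x : Fin (p + 2) → ℂ) :
    ∑ i, w i * ‖x i‖ ^ 2 = ‖relMap w x‖ ^ 2 + (∑ i, w i) * ‖centerOfMass w x‖ ^ 2 := by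
  have h1 := inner_relMap hw x x
  have h2 := sum_mul_sub_centerOfMass hw x
  rw [inner_self_eq_norm_sq_to_K] at h1
  have h3 : (((∑ i, w i * ‖x i‖ ^ 2) : ℝ) : ℂ) =
      ((‖relMap w x‖ ^ 2 + (∑ i, w i) * ‖centerOfMass w x‖ ^ 2 : ℝ) : ℂ) := by
    push_cast
    simp only [Complex.coe_algebraMap] at h1
    rw [h1]
    simp only [← Complex.conj_mul']
    have h4 : ∑ i, (w i : ℂ) * (conj (centerOfMass w x) * (x i - centerOfMass w x)) = 0 := by
      rw [← mul_zero (conj (centerOfMass w x)), ← h2, Finset.mul_sum]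
      exact Finset.sum_congr rfl fun i _ => by ring
    rw [Finset.sum_mul, ← Finset.sum_add_distrib, ← add_zero (∑ i, ((w i : ℂ) * _ + _)), ← h4,
      ← Finset.sum_add_distrib]
    refine Finset.sum_congr rfl fun i _ => ?_
    rw [map_sub]
    ring
  exact_mod_cast h3

/-- The last coordinate only translates the cluster: comparing `IsJacobi.inertia` for the last basis
vector `l` with König's decomposition leaves no intrinsic inertia to `P l`. -/
theorem relMap_mulVec_snoc (hw : ∀ i, 0 < w i) (hP : IsJacobi w P) (u : Fin (p + 1) → ℂ)
    (c : ℂ) : relMap w (P.mulVec (Fin.snoc (α := fun _ => ℂ) u c)) = jac w P u := by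
  set l : Fin (p + 2) → ℂ := Fin.snoc (α := fun _ => ℂ) (fun _ => (0 : ℂ)) 1 with hl
  have h1 : relMap w (P.mulVec l) = 0 := by
    have h2 := hP.inertia l
    have h3 := norm_sq_eq_relMap_add hw (P.mulVec l)
    rw [← hP.last_eq, h2] at h3
    have h4 : (herm (relMass w P) (fun j => l j.castSucc) fun j => l j.castSucc) = 0 := by
      have : (fun j : Fin (p + 1) => l j.castSucc) = 0 := by
        ext j
        simp [hl]
      rw [this, herm, star_zero, zero_dotProduct]
    rw [h4, Complex.zero_re] at h3
    have h5 : ‖relMap w (P.mulVec l)‖ ^ 2 = 0 := by linarith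
    exact norm_eq_zero.1 (pow_eq_zero_iff two_ne_zero |>.1 h5)
  have h2 : (Fin.snoc (α := fun _ => ℂ) u c : Fin (p + 2) → ℂ) =
      Fin.snoc (α := fun _ => ℂ) u 0 + c • l := by
    ext i
    refine Fin.lastCases ?_ (fun j => ?_) i <;> simp [hl]
  rw [h2, Matrix.mulVec_add, Matrix.mulVec_smul, map_add, map_smul, h1, smul_zero, add_zero,
    jac_apply]

theorem relMap_eq_jac (hw : ∀ i, 0 < w i) (hP : IsJacobi w P) (x : Fin (p + 2) → ℂ) :
    relMap w x = jac w P (relCoord P x) := by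
  rw [← relMap_mulVec_snoc hw hP _ (P⁻¹.mulVec x (Fin.last (p + 1)))]
  have h1 : (Fin.snoc (α := fun _ => ℂ) (relCoord P x) (P⁻¹.mulVec x (Fin.last (p + 1))) :
      Fin (p + 2) → ℂ) = P⁻¹.mulVec x := by
    ext i
    refine Fin.lastCases ?_ (fun j => ?_) i <;> simp [relCoord]
  rw [h1, Matrix.mulVec_mulVec, Matrix.mul_nonsing_inv _ hP.isUnit_det, Matrix.one_mulVec]

/-! ### Shape coordinates -/

/-- `ofC` as a continuous linear map. -/
def ofCL (p : ℕ) : (Fin p → ℂ) →L[ℝ] Shape p :=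
  LinearMap.toContinuousLinearMap
    { toFun := ofC
      map_add' := fun x y => by
        ext a
        simp only [ofC, PiLp.add_apply, Pi.add_apply]
        split_ifs <;> simp
      map_smul' := fun c x => by
        ext a
        simp only [ofC, PiLp.smul_apply, Pi.smul_apply, RingHom.id_apply]
        split_ifs <;> simp }

theorem ofCL_apply (z : Fin p → ℂ) : ofCL p z = ofC z := rfl

theorem toC_ofC (z : Fin p → ℂ) : toC (ofC z) = z := by
  ext j
  apply Complex.ext <;> simp [toC, ofC]

theorem toC_apply (s : Shape p) (j : Fin p) :
    toC s j = (s (j, 0) : ℂ) + s (j, 1) * Complex.I := by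
  rw [toC]
  exact Complex.mk_eq_add_mul_I _ _

/-- The relative configuration `(ω, 0)` as a linear function of `ω`. -/
def jacShape (w : Fin (p + 2) → ℝ) (P : Matrix (Fin (p + 2)) (Fin (p + 2)) ℂ) :
    Shape p →L[ℝ] EuclideanSpace ℂ (Fin (p + 2)) :=
  LinearMap.toContinuousLinearMap
    { toFun := fun ω => jac w P (vecExt ω 0)
      map_add' := fun x y => by
        rw [← map_add]
        congr 1
        ext i
        refine Fin.lastCases ?_ (fun j => ?_) i
        · simp [vecExt]
        · simp only [vecExt, Fin.snoc_castSucc, toC_apply, PiLp.add_apply, Pi.add_apply]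
          push_cast
          ring
      map_smul' := fun c x => by
        rw [RingHom.id_apply, ← (jac w P).map_smul_of_tower c]
        congr 1
        ext i
        refine Fin.lastCases ?_ (fun j => ?_) i
        · simp [vecExt]
        · simp only [vecExt, Fin.snoc_castSucc, toC_apply, PiLp.smul_apply, Pi.smul_apply,
            Complex.real_smul, smul_eq_mul]
          push_cast
          ring }

theorem jacShape_apply (ω : Shape p) : jacShape w P ω = jac w P (vecExt ω 0) := rfl

theorem jac_vecExt_one (s : Shape p) :
    jac w P (vecExt s 1) = jacShape w P s + jac w P (vecExt 0 1) := by
  rw [jacShape_apply, ← map_add]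
  congr 1
  ext i
  refine Fin.lastCases ?_ (fun j => ?_) i
  · simp [vecExt]
  · simp [vecExt, toC_apply]

theorem normOne_eq (hw : ∀ i, 0 < w i) (hP : IsJacobi w P) (s : Shape p) :
    normOne (relMass w P) s = ‖jac w P (vecExt s 1)‖ := by
  rw [normOne, ← inner_jac hw hP, inner_self_eq_norm_sq_to_K, ← RCLike.ofReal_pow]
  exact Real.sqrt_sq (norm_nonneg _)

theorem normOne_pos (hw : ∀ i, 0 < w i) (hP : IsJacobi w P) (s : Shape p) :
    0 < normOne (relMass w P) s := by
  rw [normOne_eq hw hP, norm_pos_iff]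
  intro h
  have := congrFun (jac_eq_zero hw hP h) (Fin.last p)
  simp [vecExt] at this

/-- The last entry of `(s, 1)` has modulus one, so the bound is uniform in `s`. -/
theorem exists_normOne_ge (hw : ∀ i, 0 < w i) (hP : IsJacobi w P) :
    ∃ κ > 0, ∀ s, κ ≤ normOne (relMass w P) s := by
  obtain ⟨K, hK, h⟩ := exists_norm_le_jac hw hP
  refine ⟨K⁻¹, inv_pos.2 hK, fun s => ?_⟩
  have h1 : (1 : ℝ) ≤ ‖vecExt s 1‖ := by
    have := norm_le_pi_norm (vecExt s 1) (Fin.last p)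
    simpa [vecExt] using this
  rw [normOne_eq hw hP, inv_le_iff_one_le_mul₀' hK]
  exact h1.trans (h _)

theorem GG_eq (hw : ∀ i, 0 < w i) (hP : IsJacobi w P) (s ω : Shape p) :
    GG (relMass w P) s ω = (inner ℂ (jac w P (vecExt s 1)) (jacShape w P ω)).re := by
  rw [GG, ← inner_jac hw hP, jacShape_apply]

theorem Om_eq (hw : ∀ i, 0 < w i) (hP : IsJacobi w P) (s ω : Shape p) :
    Om (relMass w P) s ω = (inner ℂ (jac w P (vecExt s 1)) (jacShape w P ω)).im := by
  rw [Om, ← inner_jac hw hP, jacShape_apply]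

theorem continuous_jac_vecExt : Continuous fun s : Shape p => jac w P (vecExt s 1) := by
  rw [funext (jac_vecExt_one (w := w) (P := P))]
  fun_prop

theorem continuous_normOne (hw : ∀ i, 0 < w i) (hP : IsJacobi w P) :
    Continuous (normOne (relMass w P)) := by
  simp only [funext (normOne_eq hw hP)]
  exact continuous_jac_vecExt.norm

theorem continuous_GG (hw : ∀ i, 0 < w i) (hP : IsJacobi w P) (ω : Shape p) :
    Continuous fun s => GG (relMass w P) s ω := by
  simp only [GG_eq hw hP]
  exact Complex.continuous_re.comp (continuous_jac_vecExt.inner continuous_const)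

theorem continuous_Om (hw : ∀ i, 0 < w i) (hP : IsJacobi w P) (ω : Shape p) :
    Continuous fun s => Om (relMass w P) s ω := by
  simp only [Om_eq hw hP]
  exact Complex.continuous_im.comp (continuous_jac_vecExt.inner continuous_const)

theorem continuous_AA (hw : ∀ i, 0 < w i) (hP : IsJacobi w P) :
    Continuous (AA (relMass w P)) := by
  refine continuous_matrix fun a b => ?_
  simp only [AA, Matrix.of_apply]
  have hn := continuous_normOne hw hP
  refine (continuous_const.div (hn.pow 2) fun s => pow_ne_zero _ (normOne_pos hw hP s).ne').sub
    (Continuous.div ?_ (hn.pow 4) fun s => pow_ne_zero _ (normOne_pos hw hP s).ne')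
  exact ((continuous_GG hw hP _).mul (continuous_GG hw hP _)).add
    ((continuous_Om hw hP _).mul (continuous_Om hw hP _))

theorem sum_smul_basisVec (ω : Shape p) : ∑ a, ω a • basisVec a = ω := by
  ext b
  simp [basisVec, Finset.sum_apply, Pi.single_apply]

/-- The polarization of the Fubini–Study quadratic form. -/
def fubiniStudy (w : Fin (p + 2) → ℝ) (P : Matrix (Fin (p + 2)) (Fin (p + 2)) ℂ) (s : Shape p) :
    Shape p →ₗ[ℝ] Shape p →ₗ[ℝ] ℝ :=
  LinearMap.mk₂ ℝ (fun ω η =>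
    (inner ℂ (jacShape w P ω) (jacShape w P η)).re / ‖jac w P (vecExt s 1)‖ ^ 2
      - ((inner ℂ (jac w P (vecExt s 1)) (jacShape w P ω)).re
          * (inner ℂ (jac w P (vecExt s 1)) (jacShape w P η)).re
        + (inner ℂ (jac w P (vecExt s 1)) (jacShape w P ω)).im
          * (inner ℂ (jac w P (vecExt s 1)) (jacShape w P η)).im)
        / ‖jac w P (vecExt s 1)‖ ^ 4)
    (fun x y z => by simp only [map_add, inner_add_left, inner_add_right, Complex.add_re,
      Complex.add_im]; ring)
    (fun c x y => by
      simp only [map_smul, ← Complex.coe_smul, inner_smul_left, inner_smul_right,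
        Complex.conj_ofReal, Complex.re_ofReal_mul, Complex.im_ofReal_mul, smul_eq_mul]
      ring)
    (fun x y z => by simp only [map_add, inner_add_right, Complex.add_re,
      Complex.add_im]; ring)
    (fun c x y => by
      simp only [map_smul, ← Complex.coe_smul, inner_smul_right,
        Complex.re_ofReal_mul, Complex.im_ofReal_mul, smul_eq_mul]
      ring)

theorem AA_apply (hw : ∀ i, 0 < w i) (hP : IsJacobi w P) (s : Shape p) (a b : Fin p × Fin 2) :
    AA (relMass w P) s a b = fubiniStudy w P s (basisVec a) (basisVec b) := by
  rw [AA, Matrix.of_apply, GG_eq hw hP, GG_eq hw hP, Om_eq hw hP, Om_eq hw hP, normOne_eq hw hP,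
    ← inner_jac hw hP]
  rfl

/-- Vanishing is equality in the Cauchy–Schwarz inequality, so `(ω, 0)` is a complex multiple of
`(s, 1)`; the last entry shows that the factor is zero. -/
theorem fubiniStudy_self_eq_zero (hw : ∀ i, 0 < w i) (hP : IsJacobi w P) {s ω : Shape p}
    (h : fubiniStudy w P s ω ω = 0) : ω = 0 := by
  set x := jac w P (vecExt s 1) with hx
  set y := jacShape w P ω with hy
  have hN : 0 < ‖x‖ := by
    rw [← normOne_eq hw hP]
    exact normOne_pos hw hP s
  have h1 : (inner ℂ y y).re / ‖x‖ ^ 2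
      - ((inner ℂ x y).re * (inner ℂ x y).re + (inner ℂ x y).im * (inner ℂ x y).im)
        / ‖x‖ ^ 4 = 0 := h
  have h2 : (inner ℂ y y).re = ‖y‖ ^ 2 := by
    rw [inner_self_eq_norm_sq_to_K]
    norm_cast
  rw [h2, ← Complex.normSq_apply, Complex.normSq_eq_norm_sq] at h1
  have h3 : ‖inner ℂ x y‖ = ‖x‖ * ‖y‖ := by
    rw [← sq_eq_sq₀ (norm_nonneg _) (by positivity), mul_pow]
    field_simp at h1
    linarith
  have h3' : x = 0 ∨ ∃ r : ℂ, y = r • x := ((norm_inner_eq_norm_tfae ℂ x y).out 0 2).1 h3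
  obtain ⟨r, hr⟩ := h3'.resolve_left (norm_pos_iff.1 hN)
  have h4 : vecExt ω 0 = r • vecExt s 1 := by
    apply jac_injective hw hP
    rw [map_smul]
    exact hr
  have h5 : r = 0 := by
    have := congrFun h4 (Fin.last p)
    simpa [vecExt] using this.symm
  rw [h5, zero_smul] at h4
  ext ⟨j, b⟩
  have h6 := congrFun h4 j.castSucc
  simp only [vecExt, Fin.snoc_castSucc, Pi.zero_apply] at h6
  fin_cases b
  · exact congrArg Complex.re h6
  · exact congrArg Complex.im h6

theorem det_AA_ne_zero (hw : ∀ i, 0 < w i) (hP : IsJacobi w P) (s : Shape p) :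
    (AA (relMass w P) s).det ≠ 0 := by
  intro hdet
  obtain ⟨x, hx0, hx⟩ := Matrix.exists_mulVec_eq_zero_iff.2 hdet
  set ω : Shape p := WithLp.toLp 2 x with hω
  have h1 : ∀ a, fubiniStudy w P s (basisVec a) ω = 0 := fun a => by
    have := congrFun hx a
    simp only [Matrix.mulVec, dotProduct, AA_apply hw hP, Pi.zero_apply] at this
    rw [← this, ← sum_smul_basisVec ω, map_sum]
    refine Finset.sum_congr rfl fun b _ => ?_
    rw [map_smul, smul_eq_mul, mul_comm]
  have h2 : fubiniStudy w P s ω ω = 0 := by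
    have h3 : fubiniStudy w P s ω = ∑ a, ω a • fubiniStudy w P s (basisVec a) := by
      conv_lhs => rw [← sum_smul_basisVec ω]
      rw [map_sum]
      simp only [map_smul]
    rw [h3]
    simp [LinearMap.sum_apply, h1]
  have h4 := fubiniStudy_self_eq_zero hw hP h2
  exact hx0 (by simpa [hω] using congrArg WithLp.ofLp h4)

theorem continuous_AA_inv (hw : ∀ i, 0 < w i) (hP : IsJacobi w P) :
    Continuous fun s => Matrix.toEuclideanCLM (𝕜 := ℝ) (AA (relMass w P) s)⁻¹ := by
  have h1 : Continuous fun s => (AA (relMass w P) s)⁻¹ := by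
    simp only [Matrix.inv_def, Ring.inverse_eq_inv']
    exact ((continuous_AA hw hP).matrix_det.inv₀ (det_AA_ne_zero hw hP)).smul
      (continuous_AA hw hP).matrix_adjugate
  have h2 : Continuous (Matrix.toEuclideanCLM (n := Fin p × Fin 2) (𝕜 := ℝ)) :=
    LinearMap.continuous_of_finiteDimensional
      (Matrix.toEuclideanCLM (n := Fin p × Fin 2) (𝕜 := ℝ)).toAlgEquiv.toLinearMap
  exact h2.comp h1

theorem continuous_BB (hw : ∀ i, 0 < w i) (hP : IsJacobi w P) :
    Continuous (BB (relMass w P)) :=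
  continuous_pi fun _ => continuous_Om hw hP _

/-- On bounded sets of shapes, `𝓐⁻¹` and `𝓐⁻¹𝓑/‖(s,1)‖²` are bounded. -/
theorem exists_shape_bounds (hw : ∀ i, 0 < w i) (hP : IsJacobi w P) (R : ℝ) :
    ∃ K ≥ 0, ∀ s : Shape p, ‖s‖ ≤ R →
      (∀ g : Shape p, ‖WithLp.toLp 2 ((AA (relMass w P) s)⁻¹.mulVec g.ofLp)‖ ≤ K * ‖g‖) ∧
      ‖(normOne (relMass w P) s ^ 2)⁻¹ •
        WithLp.toLp 2 ((AA (relMass w P) s)⁻¹.mulVec (BB (relMass w P) s))‖ ≤ K := by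
  have hc := isCompact_closedBall (0 : Shape p) R
  obtain ⟨K₁, hK₁⟩ := hc.exists_bound_of_continuousOn (continuous_AA_inv hw hP).continuousOn
  have h2 : Continuous fun s : Shape p => (normOne (relMass w P) s ^ 2)⁻¹ •
        WithLp.toLp 2 ((AA (relMass w P) s)⁻¹.mulVec (BB (relMass w P) s)) := by
    refine (((continuous_normOne hw hP).pow 2).inv₀
      fun s => pow_ne_zero _ (normOne_pos hw hP s).ne').smul ?_
    exact (continuous_AA_inv hw hP).clm_apply
      ((PiLp.continuous_toLp 2 _).comp (continuous_BB hw hP))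
  obtain ⟨K₂, hK₂⟩ := hc.exists_bound_of_continuousOn h2.continuousOn
  refine ⟨max (max K₁ K₂) 0, le_max_right _ _, fun s hs => ⟨fun g => ?_, ?_⟩⟩
  · have hs' : s ∈ Metric.closedBall (0 : Shape p) R := by simpa using hs
    refine ((Matrix.toEuclideanCLM (𝕜 := ℝ) (AA (relMass w P) s)⁻¹).le_opNorm g).trans ?_
    have := hK₁ s hs'
    gcongr
    exact this.trans ((le_max_left _ _).trans (le_max_left _ _))
  · have hs' : s ∈ Metric.closedBall (0 : Shape p) R := by simpa using hs
    exact (hK₂ s hs').trans ((le_max_right _ _).trans (le_max_left _ _))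

end Jacobi

/-! ### The coordinates along the orbit -/

section Orbit

variable {n p : ℕ} {m : Fin n → ℝ} {q v : ℝ → Fin n → ℂ} {t₀ T : ℝ} {e : Fin (p + 2) ↪ Fin n}
  {P : Matrix (Fin (p + 2)) (Fin (p + 2)) ℂ}

/-- `relCoord` as a continuous linear map. -/
def relCoordL {p : ℕ} (P : Matrix (Fin (p + 2)) (Fin (p + 2)) ℂ) :
    (Fin (p + 2) → ℂ) →L[ℂ] (Fin (p + 1) → ℂ) :=
  LinearMap.toContinuousLinearMap
    { toFun := relCoord P
      map_add' := fun x y => by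
        ext j
        simp [relCoord, Matrix.mulVec_add]
      map_smul' := fun c x => by
        ext j
        simp [relCoord, Matrix.mulVec_smul] }

theorem hasDerivAt_relCoord (hq : IsOrbit m q v t₀ T) {t : ℝ} (ht : t ∈ Ioo t₀ T)
    (j : Fin (p + 1)) : HasDerivAt (fun u => relCoord P (cluster e q u) j)
      (relCoord P (cluster e v t) j) t :=
  hasDerivAt_pi.1 ((hasDerivAt_pi.2 fun i => hq.hasDerivAt_position ht (e i)).clm_apply_const
    (relCoordL P)) j

theorem hasDerivAt_ss (hq : IsOrbit m q v t₀ T) {t : ℝ} (ht : t ∈ Ioo t₀ T)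
    (hz : zTop e P q t ≠ 0) : HasDerivAt (ss e P q) (ofC fun j : Fin p =>
      (relCoord P (cluster e v t) j.castSucc * zTop e P q t
        - relCoord P (cluster e q t) j.castSucc * zTop e P v t) / zTop e P q t ^ 2) t :=
  (ofCL p).hasFDerivAt.comp_hasDerivAt t (hasDerivAt_pi.2 fun j =>
    (hasDerivAt_relCoord hq ht j.castSucc).div (hasDerivAt_relCoord hq ht (Fin.last p)) hz)

theorem relCoord_eq_smul {t : ℝ} (hz : zTop e P q t ≠ 0) :
    relCoord P (cluster e q t) = zTop e P q t • vecExt (ss e P q t) 1 := by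
  ext i
  refine Fin.lastCases ?_ (fun j => ?_) i
  · simp [vecExt, zTop]
  · simp only [vecExt, ss, toC_ofC, Pi.smul_apply, Fin.snoc_castSucc, smul_eq_mul]
    field_simp

/-- The momentum `μ` conjugate to `θ` is the intrinsic angular momentum. -/
theorem mu_eq (hm : ∀ i, 0 < m i) (hP : IsJacobi (m ∘ e) P) (hq : IsOrbit m q v t₀ T) {t : ℝ}
    (ht : t ∈ Ioo t₀ T) (hz : zTop e P q t ≠ 0) :
    mu m e P q t = (posVel m e q v t).im := by
  have hw : ∀ i, 0 < (m ∘ e) i := fun i => hm _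
  set z := zTop e P q t with hzdef
  set z' := zTop e P v t with hz'
  set s := ss e P q t with hs
  set s' := deriv (ss e P q) t with hs'
  set a := jac (m ∘ e) P (vecExt s 1) with ha
  set b := jacShape (m ∘ e) P s' with hb
  have hzd : deriv (zTop e P q) t = z' := (hasDerivAt_relCoord hq ht (Fin.last p)).deriv
  have h1 : relMap (m ∘ e) (cluster e q t) = z • a := by
    rw [relMap_eq_jac hw hP, relCoord_eq_smul hz, map_smul]
  have h2 : relMap (m ∘ e) (cluster e v t) = z' • a + z • b := by
    rw [relMap_eq_jac hw hP, hb, jacShape_apply, ha, ← map_smul, ← map_smul, ← map_add]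
    congr 1
    ext i
    refine Fin.lastCases ?_ (fun j => ?_) i
    · simp [vecExt, hz', zTop]
    · rw [hs', (hasDerivAt_ss hq ht hz).deriv]
      simp only [vecExt, hs, ss, toC_ofC, Pi.smul_apply, Pi.add_apply, Fin.snoc_castSucc,
        smul_eq_mul]
      rw [← hzdef, ← hz']
      field_simp
      ring
  have hN : normOne (relMass (m ∘ e) P) s = ‖a‖ := normOne_eq hw hP s
  have hN0 : 0 < ‖a‖ := hN ▸ normOne_pos hw hP s
  have hr : rr m e q t = ‖z‖ * ‖a‖ := by
    rw [rr, ← norm_relMap hw, h1, norm_smul]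
  -- Since `r = |z| ‖a‖` and `θ̇ = Im (z'/z)`, the imaginary parts of the two summands are the two
  -- terms of `μ`.
  have h3 : posVel m e q v t = ((‖z‖ ^ 2 * ‖a‖ ^ 2 : ℝ) : ℂ) * (z' / z)
      + ((‖z‖ ^ 2 : ℝ) : ℂ) * inner ℂ a b := by
    rw [posVel, h1, h2, inner_add_right, inner_smul_left, inner_smul_left, inner_smul_right,
      inner_smul_right, inner_self_eq_norm_sq_to_K]
    push_cast
    rw [← Complex.conj_mul' z]
    simp only [Complex.coe_algebraMap]
    field_simp
  rw [h3, Complex.add_im, Complex.im_ofReal_mul, Complex.im_ofReal_mul, mu, thetaDot, hzd,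
    ← hs, ← hs', hN, hr, Om_eq hw hP, ← ha, ← hb, ← hzdef]
  field_simp

/-- Normalized configurations lie in a compact ball, so if `|z_{k-1}|/r` were not bounded away from
zero, some limit point would lie outside the chart. -/
theorem exists_zTop_ge (hm : ∀ i, 0 < m i) (ht : t₀ < T) (hP : IsJacobi (m ∘ e) P)
    (hq : IsOrbit m q v t₀ T)
    (hlim : ∀ x : Fin (p + 2) → ℂ, MapClusterPt x (𝓝[<] T) (qHat m e q) →
      relCoord P x (Fin.last p) ≠ 0) :
    ∃ δ > 0, ∀ᶠ t in 𝓝[<] T, δ * rr m e q t ≤ ‖zTop e P q t‖ := by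
  have hw : ∀ i, 0 < (m ∘ e) i := fun i => hm _
  have hpos : ∀ᶠ t in 𝓝[<] T, 0 < rr m e q t := by
    filter_upwards [Ioo_mem_nhdsLT ht] with t ht
    exact size_cluster_pos hm hq ⟨ht.1.le, ht.2⟩
  set g : (Fin (p + 2) → ℂ) → ℝ := fun x => ‖relCoord P x (Fin.last p)‖ with hg
  have hgc : Continuous g := ((continuous_apply (Fin.last p)).comp (relCoordL P).continuous).norm
  have h1 : ∃ δ > 0, ∀ᶠ t in 𝓝[<] T, δ ≤ g (qHat m e q t) := by
    by_contra! hcon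
    -- A filter in place of a sequence: it refines `t ↗ T` and forces `g` to tend to zero; the
    -- negated claim makes it nontrivial.
    set l := 𝓝[<] T ⊓ comap (fun t => g (qHat m e q t)) (𝓝[≥] 0) with hl
    have hne : l.NeBot := by
      rw [hl, inf_neBot_iff_frequently_right]
      intro S hS
      rw [eventually_comap] at hS
      obtain ⟨u, hu, hS⟩ := (nhdsGE_basis (0 : ℝ)).eventually_iff.1 hS
      refine (hcon u hu).mono fun t h => hS ⟨norm_nonneg _, ?_⟩ t rfl
      exact h
    have hbd : ∀ᶠ t in l, qHat m e q t ∈ Metric.closedBall (0 : Fin (p + 2) → ℂ)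
        (∑ i, (√((m ∘ e) i))⁻¹) := by
      refine Eventually.filter_mono inf_le_left ?_
      filter_upwards [hpos] with t h
      rw [mem_closedBall_zero_iff, pi_norm_le_iff_of_nonneg
        (Finset.sum_nonneg fun i _ => inv_nonneg.2 (Real.sqrt_nonneg _))]
      intro i
      have h2 := norm_sub_centerOfMass_le hw (cluster e q t) i
      have h3 : 0 < size (m ∘ e) (cluster e q t) := h
      rw [qHat, normalized, norm_smul, norm_inv, Real.norm_eq_abs, abs_of_pos h3,
        inv_mul_le_iff₀ h3, mul_comm]
      refine h2.trans (mul_le_mul_of_nonneg_right ?_ h3.le)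
      exact Finset.single_le_sum (f := fun i => (√((m ∘ e) i))⁻¹)
        (fun i _ => inv_nonneg.2 (Real.sqrt_nonneg _)) (Finset.mem_univ i)
    obtain ⟨x, -, hx⟩ := (isCompact_closedBall _ _).exists_mapClusterPt_of_frequently
      hbd.frequently
    have h2 := hlim x (hx.mono inf_le_left)
    have h3 : MapClusterPt (g x) l (fun t => g (qHat m e q t)) :=
      MapClusterPt.tendsto_comp (f := g) (hgc.tendsto x) hx
    have h4 : Tendsto (fun t => g (qHat m e q t)) l (𝓝 0) :=
      (tendsto_comap.mono_left inf_le_right).mono_right nhdsWithin_le_nhds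
    have h5 : g x = 0 := by
      have : ClusterPt (g x) (𝓝 (0 : ℝ)) := ClusterPt.mono h3 h4
      exact eq_of_nhds_neBot this
    exact h2 (norm_eq_zero.1 h5)
  obtain ⟨δ, hδ, h⟩ := h1
  refine ⟨δ, hδ, ?_⟩
  filter_upwards [h, hpos] with t h hr
  -- Relative coordinates ignore translations and are homogeneous; both facts are read off through
  -- the injective map `jac`.
  have h2 : relCoord P (qHat m e q t) = ((rr m e q t : ℂ))⁻¹ • relCoord P (cluster e q t) := by
    apply jac_injective hw hP
    rw [map_smul, ← relMap_eq_jac hw hP, ← relMap_eq_jac hw hP, ← map_smul]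
    have hc0 : centerOfMass (m ∘ e) (cluster e q t - fun _ => cc m e q t) = 0 := by
      have := sum_mul_sub_centerOfMass hw (cluster e q t)
      rw [centerOfMass]
      simp only [Complex.real_smul, Pi.sub_apply, cc]
      rw [this, mul_zero]
    have hqh : qHat m e q t = ((rr m e q t : ℂ))⁻¹ • (cluster e q t - fun _ => cc m e q t) := by
      ext i
      simp [qHat, normalized, rr, cc]
    rw [hqh, map_smul, map_smul]
    congr 1
    ext i
    rw [relMap_apply, relMap_apply, hc0, sub_zero]
    rfl
  simp only [hg] at h
  rw [h2, Pi.smul_apply, norm_smul, norm_inv, Complex.norm_real, Real.norm_eq_abs,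
    abs_of_pos hr, le_inv_mul_iff₀ hr] at h
  rw [zTop]
  linarith

/-- In `s_j = z_j / z_{k-1}` the numerator is at most `K r` and the denominator at least `δ r`. -/
theorem exists_ss_le (hm : ∀ i, 0 < m i) (ht : t₀ < T) (hP : IsJacobi (m ∘ e) P)
    (hq : IsOrbit m q v t₀ T)
    (hlim : ∀ x : Fin (p + 2) → ℂ, MapClusterPt x (𝓝[<] T) (qHat m e q) →
      relCoord P x (Fin.last p) ≠ 0) :
    ∃ R, ∀ᶠ t in 𝓝[<] T, zTop e P q t ≠ 0 ∧ ‖ss e P q t‖ ≤ R := by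
  have hw : ∀ i, 0 < (m ∘ e) i := fun i => hm _
  obtain ⟨δ, hδ, h⟩ := exists_zTop_ge hm ht hP hq hlim
  obtain ⟨K, hK, hKj⟩ := exists_norm_le_jac hw hP
  refine ⟨‖ofCL p‖ * (K / δ), ?_⟩
  filter_upwards [h, Ioo_mem_nhdsLT ht] with t h htt
  have hr : 0 < rr m e q t := size_cluster_pos hm hq ⟨htt.1.le, htt.2⟩
  have hz : 0 < ‖zTop e P q t‖ := (mul_pos hδ hr).trans_le h
  refine ⟨norm_pos_iff.1 hz, ?_⟩
  rw [ss, ← ofCL_apply]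
  refine ((ofCL p).le_opNorm _).trans (mul_le_mul_of_nonneg_left ?_ (norm_nonneg _))
  rw [pi_norm_le_iff_of_nonneg (by positivity)]
  intro j
  have h1 := (norm_le_pi_norm (relCoord P (cluster e q t)) j.castSucc).trans (hKj _)
  rw [← relMap_eq_jac hw hP, norm_relMap hw] at h1
  rw [norm_div, div_le_div_iff₀ hz hδ]
  calc ‖relCoord P (cluster e q t) j.castSucc‖ * δ ≤ K * rr m e q t * δ := by
        exact mul_le_mul_of_nonneg_right h1 hδ.le
    _ = K * (δ * rr m e q t) := by ring
    _ ≤ K * ‖zTop e P q t‖ := mul_le_mul_of_nonneg_left h hK.le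

/-! ### The external potential -/

theorem abs_extPotential_sub_le (hm : ∀ i, 0 < m i) {d : ℝ} (hd : 0 < d) {Q : Fin n → ℂ}
    {y y' : Fin (p + 2) → ℂ} (hy : ∀ i, ∀ j ∉ range e, d ≤ ‖y i - Q j‖)
    (hy' : ∀ i, ∀ j ∉ range e, d ≤ ‖y' i - Q j‖) :
    |extPotential m e y Q - extPotential m e y' Q| ≤
      (∑ i, ∑ j, m (e i) * m j / d ^ 2) * ‖y - y'‖ := by
  classical
  rw [extPotential, extPotential, ← Finset.sum_sub_distrib, Finset.sum_mul]
  refine (Finset.abs_sum_le_sum_abs _ _).trans (Finset.sum_le_sum fun i _ => ?_)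
  rw [← Finset.sum_sub_distrib, Finset.sum_mul]
  refine (Finset.abs_sum_le_sum_abs _ _).trans
    ((Finset.sum_le_sum fun j hj => ?_).trans (Finset.sum_le_sum_of_subset_of_nonneg
      (Finset.filter_subset (fun j => j ∉ range e) Finset.univ) fun j _ _ => ?_))
  · have hj' : j ∉ range e := (Finset.mem_filter.1 hj).2
    have h1 := hy i j hj'
    have h2 := hy' i j hj'
    have h3 : 0 < ‖y i - Q j‖ := hd.trans_le h1
    have h4 : 0 < ‖y' i - Q j‖ := hd.trans_le h2
    have hmm : 0 < m (e i) * m j := mul_pos (hm _) (hm _)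
    rw [div_sub_div _ _ h3.ne' h4.ne', ← mul_comm (m (e i) * m j), ← mul_sub, abs_div, abs_mul,
      abs_of_pos hmm, abs_of_pos (mul_pos h3 h4), mul_div_right_comm]
    have h5 : |‖y' i - Q j‖ - ‖y i - Q j‖| ≤ ‖y - y'‖ := by
      refine (abs_norm_sub_norm_le _ _).trans ?_
      rw [sub_sub_sub_cancel_right, norm_sub_rev]
      exact norm_le_pi_norm (y - y') i
    have h6 : d ^ 2 ≤ ‖y i - Q j‖ * ‖y' i - Q j‖ := by
      rw [sq]
      exact mul_le_mul h1 h2 hd.le h3.le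
    gcongr
  · have := hm (e i)
    have := hm j
    positivity

theorem relMap_chart (hw : ∀ i, 0 < (m ∘ e) i) (hP : IsJacobi (m ∘ e) P) (ρ θ : ℝ)
    (s : Shape p) (c : ℂ) : relMap (m ∘ e) (chart (m ∘ e) P ρ θ s c) =
      ((ρ : ℂ) * Complex.exp (θ * Complex.I)) •
        ((‖jac (m ∘ e) P (vecExt s 1)‖⁻¹ : ℝ) • jac (m ∘ e) P (vecExt s 1)) := by
  rw [chart, relMap_mulVec_snoc hw hP, ← normOne_eq hw hP, ← Complex.coe_smul, ← map_smul,
    ← map_smul]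
  congr 1
  ext j
  simp only [Pi.smul_apply, smul_eq_mul]
  push_cast
  ring

theorem norm_sub_le_of_centerOfMass_eq {w : Fin (p + 2) → ℝ} (hw : ∀ i, 0 < w i)
    {y y' : Fin (p + 2) → ℂ} (hc : centerOfMass w y = centerOfMass w y') :
    ‖y - y'‖ ≤ (∑ i, (√(w i))⁻¹) * ‖relMap w y - relMap w y'‖ := by
  have hn : ∀ i, 0 ≤ (√(w i))⁻¹ := fun i => inv_nonneg.2 (Real.sqrt_nonneg _)
  rw [pi_norm_le_iff_of_nonneg
    (mul_nonneg (Finset.sum_nonneg fun i _ => hn i) (norm_nonneg _))]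
  intro i
  have h1 := norm_sub_centerOfMass_le hw (y - y') i
  have h2 : centerOfMass w (y - y') = 0 := by
    have := centerOfMass_add w (y - y') y'
    rw [sub_add_cancel, hc] at this
    exact left_eq_add.1 (by rw [add_comm, ← this])
  rw [h2, sub_zero, ← norm_relMap hw, map_sub] at h1
  refine h1.trans (mul_le_mul_of_nonneg_right ?_ (norm_nonneg _))
  exact Finset.single_le_sum (f := fun i => (√(w i))⁻¹) (fun i _ => hn i) (Finset.mem_univ i)

/-- The constant involves `b` alone: `b` will be the base point at which the derivative in `s` is
taken. -/
theorem norm_normalize_sub_le {E : Type*} [NormedAddCommGroup E] [NormedSpace ℝ E] {a b : E}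
    (ha : a ≠ 0) (hb : b ≠ 0) : ‖‖a‖⁻¹ • a - ‖b‖⁻¹ • b‖ ≤ 2 * ‖b‖⁻¹ * ‖a - b‖ := by
  have ha' := norm_pos_iff.2 ha
  have hb' := norm_pos_iff.2 hb
  have h1 : ‖a‖⁻¹ • a - ‖b‖⁻¹ • b = ‖b‖⁻¹ • (a - b) + (‖a‖⁻¹ - ‖b‖⁻¹) • a := by
    rw [smul_sub, sub_smul]
    abel
  have h2 : |‖a‖⁻¹ - ‖b‖⁻¹| * ‖a‖ = ‖b‖⁻¹ * |‖a‖ - ‖b‖| := by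
    have h3 : ‖a‖⁻¹ - ‖b‖⁻¹ = -(‖a‖⁻¹ * (‖b‖⁻¹ * (‖a‖ - ‖b‖))) := by
      field_simp
      ring
    rw [h3, abs_neg, abs_mul, abs_mul, abs_of_pos (inv_pos.2 ha'), abs_of_pos (inv_pos.2 hb')]
    field_simp
  rw [h1]
  refine (norm_add_le _ _).trans ?_
  rw [norm_smul, norm_smul, norm_inv, norm_norm, Real.norm_eq_abs, h2]
  have := mul_le_mul_of_nonneg_left (abs_norm_sub_norm_le a b) (inv_pos.2 hb').le
  linarith

/-- Near the collision the cluster, in whatever position of the given size, stays away from the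
other bodies. -/
theorem exists_chart_dist_ge (hm : ∀ i, 0 < m i) (hP : IsJacobi (m ∘ e) P)
    (hcol : IsPartialCollision q T e) :
    ∃ d > 0, ∀ᶠ t in 𝓝[<] T, ∀ ρ θ s, 0 ≤ ρ → ρ ≤ 2 * rr m e q t →
      ∀ i, ∀ j ∉ range e, d ≤ ‖chart (m ∘ e) P ρ θ s (cc m e q t) i - q t j‖ := by
  have hw : ∀ i, 0 < (m ∘ e) i := fun i => hm _
  have hr := tendsto_rr hm hcol
  obtain ⟨L, hL, hcl⟩ := hcol.exists_limit
  have hc := tendsto_cc hm hL hcl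
  have h1 : ∀ᶠ d in 𝓝[>] (0 : ℝ), ∀ j, j ∉ range e → d < ‖L (e 0) - L j‖ := by
    refine eventually_all.2 fun j => ?_
    by_cases hj : j ∈ range e
    · exact Eventually.of_forall fun _ h => absurd hj h
    · have h2 : 0 < ‖L (e 0) - L j‖ :=
        norm_pos_iff.2 (sub_ne_zero.2 fun h => hj ((hcl j).2 h.symm))
      filter_upwards [nhdsWithin_le_nhds (gt_mem_nhds h2)] with d hd _ using hd
  obtain ⟨d, hd, hd0⟩ := (h1.and self_mem_nhdsWithin).exists
  set K := ∑ i, (√((m ∘ e) i))⁻¹ with hK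
  have h3 : ∀ᶠ t in 𝓝[<] T, ∀ j, j ∉ range e →
      d < ‖cc m e q t - q t j‖ - K * (2 * rr m e q t) := by
    refine eventually_all.2 fun j => ?_
    by_cases hj : j ∈ range e
    · exact Eventually.of_forall fun _ h => absurd hj h
    · have h4 := (hc.sub (hL j)).norm.sub ((hr.const_mul 2).const_mul K)
      rw [mul_zero, mul_zero, sub_zero] at h4
      filter_upwards [h4.eventually (lt_mem_nhds (hd j hj))] with t ht _ using ht
  refine ⟨d, hd0, ?_⟩
  filter_upwards [h3] with t ht ρ θ s hρ hρr i j hj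
  have h5 := norm_sub_centerOfMass_le hw (chart (m ∘ e) P ρ θ s (cc m e q t)) i
  have hN := normOne_pos hw hP s
  rw [normOne_eq hw hP] at hN
  have h6 : size (m ∘ e) (chart (m ∘ e) P ρ θ s (cc m e q t)) = ρ := by
    rw [← norm_relMap hw, relMap_chart hw hP, norm_smul, norm_smul, norm_mul,
      Complex.norm_exp_ofReal_mul_I, norm_inv, norm_norm, inv_mul_cancel₀ hN.ne',
      Complex.norm_real, Real.norm_eq_abs, abs_of_nonneg hρ, mul_one, mul_one]
  have h7 : centerOfMass (m ∘ e) (chart (m ∘ e) P ρ θ s (cc m e q t)) = cc m e q t :=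
    centerOfMass_mulVec_snoc hP _ _
  rw [h6, h7] at h5
  have h8 : (√((m ∘ e) i))⁻¹ ≤ K :=
    Finset.single_le_sum (f := fun i => (√((m ∘ e) i))⁻¹)
      (fun i _ => inv_nonneg.2 (Real.sqrt_nonneg _)) (Finset.mem_univ i)
  have h9 : (√((m ∘ e) i))⁻¹ * ρ ≤ K * (2 * rr m e q t) :=
    mul_le_mul h8 hρr hρ ((inv_nonneg.2 (Real.sqrt_nonneg _)).trans h8)
  have h10 := norm_sub_norm_le (cc m e q t - q t j)
    (cc m e q t - chart (m ∘ e) P ρ θ s (cc m e q t) i)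
  rw [sub_sub_sub_cancel_left, norm_sub_rev (cc m e q t) (chart _ _ _ _ _ _ i)] at h10
  linarith [ht j hj]

/-- Bounds on the partial derivatives of the external potential. -/
theorem exists_dU_le (hm : ∀ i, 0 < m i) (ht : t₀ < T) (hP : IsJacobi (m ∘ e) P)
    (hq : IsOrbit m q v t₀ T) (hcol : IsPartialCollision q T e) :
    ∃ C ≥ 0, ∀ᶠ t in 𝓝[<] T, |dUdr m e P q t| ≤ C ∧ ‖dUds m e P q t‖ ≤ C * rr m e q t := by
  have hw : ∀ i, 0 < (m ∘ e) i := fun i => hm _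
  obtain ⟨d, hd, hdist⟩ := exists_chart_dist_ge hm hP hcol
  obtain ⟨κ, hκ, hκN⟩ := exists_normOne_ge hw hP
  set K := ∑ i, (√((m ∘ e) i))⁻¹ with hK
  have hK0 : 0 ≤ K := Finset.sum_nonneg fun i _ => inv_nonneg.2 (Real.sqrt_nonneg _)
  set A := ∑ i, ∑ j, m (e i) * m j / d ^ 2 with hA
  have hA0 : 0 ≤ A := Finset.sum_nonneg fun i _ => Finset.sum_nonneg fun j _ =>
    div_nonneg (mul_pos (hm _) (hm _)).le (by positivity)
  set B := 2 * κ⁻¹ * ‖jacShape (m ∘ e) P‖ with hB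
  have hB0 : 0 ≤ B := by positivity
  refine ⟨A * K + A * K * B, by positivity, ?_⟩
  filter_upwards [hdist, Ioo_mem_nhdsLT ht] with t hdist htt
  have hr : 0 < rr m e q t := size_cluster_pos hm hq ⟨htt.1.le, htt.2⟩
  have hjac : ∀ s : Shape p, jac (m ∘ e) P (vecExt s 1) ≠ 0 := fun s => by
    rw [← norm_pos_iff, ← normOne_eq hw hP]
    exact normOne_pos hw hP s
  -- The partial derivatives are bounded by Lipschitz constants, so differentiability of `U_ext`
  -- need not be shown. The chart has unit speed in `r` and is Lipschitz in `s` with a constant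
  -- proportional to `r`.
  have hlip : ∀ ρ ρ' θ s s', 0 ≤ ρ → ρ ≤ 2 * rr m e q t → 0 ≤ ρ' → ρ' ≤ 2 * rr m e q t →
      |UExt m e P (q t) ρ θ s (cc m e q t) - UExt m e P (q t) ρ' θ s' (cc m e q t)| ≤
      A * (K * ‖relMap (m ∘ e) (chart (m ∘ e) P ρ θ s (cc m e q t))
        - relMap (m ∘ e) (chart (m ∘ e) P ρ' θ s' (cc m e q t))‖) := by
    intro ρ ρ' θ s s' h1 h2 h3 h4
    refine (abs_extPotential_sub_le hm hd (hdist ρ θ s h1 h2) (hdist ρ' θ s' h3 h4)).trans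
      (mul_le_mul_of_nonneg_left (norm_sub_le_of_centerOfMass_eq hw ?_) hA0)
    rw [chart, chart, centerOfMass_mulVec_snoc hP, centerOfMass_mulVec_snoc hP]
  constructor
  · have h1 : ‖dUdr m e P q t‖ ≤ A * K := by
      refine norm_deriv_le_of_lip' (by positivity) ?_
      -- The range up to `2r` in `exists_chart_dist_ge` leaves room for a neighbourhood of `r`.
      filter_upwards [Ioo_mem_nhds hr (by linarith : rr m e q t < 2 * rr m e q t)] with ρ hρ
      refine (hlip ρ _ _ _ _ hρ.1.le hρ.2.le hr.le (by linarith)).trans (le_of_eq ?_)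
      rw [relMap_chart hw hP, relMap_chart hw hP, ← sub_smul, ← sub_mul, norm_smul, norm_smul,
        norm_mul, Complex.norm_exp_ofReal_mul_I, norm_inv, norm_norm,
        inv_mul_cancel₀ (norm_ne_zero_iff.2 (hjac _)), ← Complex.ofReal_sub, Complex.norm_real]
      ring
    rw [Real.norm_eq_abs] at h1
    exact h1.trans (le_add_of_nonneg_right (by positivity))
  · have h1 : ‖dUds m e P q t‖ ≤ A * K * B * rr m e q t := by
      rw [dUds, gradient, LinearIsometryEquiv.norm_map]
      refine norm_fderiv_le_of_lip' ℝ (by positivity) (Eventually.of_forall fun s => ?_)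
      refine (hlip _ _ _ _ _ hr.le (by linarith) hr.le (by linarith)).trans ?_
      rw [relMap_chart hw hP, relMap_chart hw hP, ← smul_sub, norm_smul, norm_mul,
        Complex.norm_exp_ofReal_mul_I, Complex.norm_real, Real.norm_eq_abs, abs_of_pos hr, mul_one]
      have h2 := norm_normalize_sub_le (hjac s) (hjac (ss e P q t))
      have h3 : ‖jac (m ∘ e) P (vecExt s 1) - jac (m ∘ e) P (vecExt (ss e P q t) 1)‖ ≤
          ‖jacShape (m ∘ e) P‖ * ‖s - ss e P q t‖ := by
        rw [jac_vecExt_one s, jac_vecExt_one (ss e P q t), add_sub_add_right_eq_sub, ← map_sub]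
        exact (jacShape (m ∘ e) P).le_opNorm _
      have h4 : ‖jac (m ∘ e) P (vecExt (ss e P q t) 1)‖⁻¹ ≤ κ⁻¹ := by
        rw [← normOne_eq hw hP]
        exact inv_anti₀ hκ (hκN _)
      have h5 : 2 * ‖jac (m ∘ e) P (vecExt (ss e P q t) 1)‖⁻¹ *
          ‖jac (m ∘ e) P (vecExt s 1) - jac (m ∘ e) P (vecExt (ss e P q t) 1)‖ ≤
          2 * κ⁻¹ * (‖jacShape (m ∘ e) P‖ * ‖s - ss e P q t‖) := by
        gcongr
      calc _ ≤ A * (K * (rr m e q t * (2 * κ⁻¹ * (‖jacShape (m ∘ e) P‖ * ‖s - ss e P q t‖)))) := by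
            gcongr
            exact h2.trans h5
        _ = A * K * B * rr m e q t * ‖s - ss e P q t‖ := by
            rw [hB]
            ring
    refine h1.trans (mul_le_mul_of_nonneg_right ?_ hr.le)
    exact le_add_of_nonneg_left (by positivity)

end Orbit

/-! ### Regularized time along the orbit and the common bound `O(r)`. -/

section Final

variable {n p : ℕ} {m : Fin n → ℝ} {q v : ℝ → Fin n → ℂ} {t₀ T : ℝ} {e : Fin (p + 2) ↪ Fin n}
  {P : Matrix (Fin (p + 2)) (Fin (p + 2)) ℂ}

theorem continuousOn_rr (hm : ∀ i, 0 < m i) (hq : IsOrbit m q v t₀ T) :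
    ContinuousOn (rr m e q) (Ico t₀ T) := by
  have hw : ∀ i, 0 < (m ∘ e) i := fun i => hm _
  have h1 : rr m e q = fun t => ‖relMap (m ∘ e) (cluster e q t)‖ :=
    funext fun t => (norm_relMap hw _).symm
  rw [h1]
  refine ((relMap (m ∘ e)).continuous.comp_continuousOn (continuousOn_pi.2 fun i t ht => ?_)).norm
  exact (hq.velocity t ht (e i)).continuousWithinAt

theorem continuousOn_tau_integrand (hm : ∀ i, 0 < m i) (hq : IsOrbit m q v t₀ T) :
    ContinuousOn (fun u => rr m e q u ^ (-(3 / 2) : ℝ)) (Ico t₀ T) :=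
  (continuousOn_rr hm hq).rpow_const fun _ ht => Or.inl (size_cluster_pos hm hq ht).ne'

theorem hasDerivAt_tau (hm : ∀ i, 0 < m i) (hq : IsOrbit m q v t₀ T) {t : ℝ}
    (ht : t ∈ Ioo t₀ T) :
    HasDerivAt (tau m e q t₀) (rr m e q t ^ (-(3 / 2) : ℝ)) t := by
  have hc := continuousOn_tau_integrand (e := e) hm hq
  have hc' := hc.mono Ioo_subset_Ico_self
  exact intervalIntegral.integral_hasDerivAt_right
    ((hc.mono (Icc_subset_Ico_right ht.2)).intervalIntegrable_of_Icc ht.1.le)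
    (hc'.stronglyMeasurableAtFilter isOpen_Ioo t ht) (hc'.continuousAt (Ioo_mem_nhds ht.1 ht.2))

theorem monotoneOn_tau (hm : ∀ i, 0 < m i) (hq : IsOrbit m q v t₀ T) :
    MonotoneOn (tau m e q t₀) (Ico t₀ T) := by
  intro t ht t' ht' htt
  refine intervalIntegral.integral_mono_interval le_rfl ht.1 htt
    (Eventually.of_forall fun u => Real.rpow_nonneg (Real.sqrt_nonneg _) _) ?_
  exact ((continuousOn_tau_integrand hm hq).mono
    (Icc_subset_Ico_right ht'.2)).intervalIntegrable_of_Icc ht'.1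

/-- All quantities of interest are `O(r)` near the collision. -/
theorem exists_le_rr (hm : ∀ i, 0 < m i) (ht : t₀ < T) (hP : IsJacobi (m ∘ e) P)
    (hq : IsOrbit m q v t₀ T) (hcol : IsPartialCollision q T e)
    (hlim : ∀ x : Fin (p + 2) → ℂ, MapClusterPt x (𝓝[<] T) (qHat m e q) →
      relCoord P x (Fin.last p) ≠ 0) {t₂ C D : ℝ} (ht₂ : t₂ ∈ Ioo t₀ T) (hD : 0 < D)
    (ha : ∀ t ∈ Ioo t₂ T, (posVel m e q v t).im ^ 2 ≤ D * rr m e q t ^ 2)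
    {a' : ℝ → ℝ} (ha' : ∀ t ∈ Ioo t₂ T, HasDerivAt (fun u => (posVel m e q v u).im) (a' t) t)
    (hC : ∀ t ∈ Ioo t₂ T, |a' t| ≤ C * rr m e q t) :
    ∃ M > 0, ∃ t₃ ∈ Ioo t₂ T, ∀ t ∈ Ioo t₃ T, zTop e P q t ≠ 0 ∧
      max ‖mu m e P q t ^ 2 / rr m e q t + rr m e q t ^ 2 * dUdr m e P q t‖
        ‖rr m e q t ^ 2 • dUds m e P q t
          - (rr m e q t * deriv (mu m e P q) t) • ABn m e P q t‖ ≤ M * rr m e q t ∧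
      ‖rr m e q t • AdUds m e P q t
          - (rr m e q t * deriv (mu m e P q) t) • ABn m e P q t‖ ≤ M * rr m e q t := by
  have hw : ∀ i, 0 < (m ∘ e) i := fun i => hm _
  obtain ⟨R, hR⟩ := exists_ss_le hm ht hP hq hlim
  obtain ⟨K, hK0, hK⟩ := exists_shape_bounds hw hP R
  obtain ⟨B, hB0, hB⟩ := exists_dU_le hm ht hP hq hcol
  have hr1 := (tendsto_rr hm hcol).eventually (gt_mem_nhds one_pos)
  obtain ⟨t₃, ht₃, h3⟩ := exists_Ioo_of_eventually ht₂.2 (hR.and (hB.and hr1))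
  have hs : ∀ t ∈ Ioo t₃ T, t ∈ Ioo t₂ T := fun t h => ⟨ht₃.1.trans h.1, h.2⟩
  have hs0 : ∀ t ∈ Ioo t₃ T, t ∈ Ioo t₀ T := fun t h => ⟨ht₂.1.trans (hs t h).1, h.2⟩
  have hmu : ∀ t ∈ Ioo t₃ T, mu m e P q t = (posVel m e q v t).im := fun t h =>
    mu_eq hm hP hq (hs0 t h) (h3 t h).1.1
  have hC0 : 0 ≤ C := by
    have h : (t₂ + T) / 2 ∈ Ioo t₂ T := ⟨by linarith [ht₂.2], by linarith [ht₂.2]⟩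
    have h4 := (abs_nonneg _).trans (hC _ h)
    exact nonneg_of_mul_nonneg_left h4
      (size_cluster_pos hm hq ⟨(ht₂.1.trans h.1).le, h.2⟩)
  -- One constant for the three estimates, which require `D + B`, `B + C K` and `K B + C K`; surplus
  -- powers of `r` are dropped since `r < 1`.
  refine ⟨D + 2 * B + C * K + K * B, by positivity, t₃, ht₃, fun t h => ?_⟩
  obtain ⟨⟨hz, hss⟩, ⟨hdr, hds⟩, hrlt⟩ := h3 t h
  obtain ⟨hA, hAB⟩ := hK _ hss
  have hAB : ‖ABn m e P q t‖ ≤ K := hAB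
  have hAd : ‖AdUds m e P q t‖ ≤ K * ‖dUds m e P q t‖ := hA _
  have hdmu : deriv (mu m e P q) t = a' t := by
    have : mu m e P q =ᶠ[𝓝 t] fun u => (posVel m e q v u).im := by
      filter_upwards [Ioo_mem_nhds h.1 h.2] with u hu using hmu u hu
    rw [this.deriv_eq, (ha' t (hs t h)).deriv]
  rw [hmu t h, hdmu]
  have hr : 0 < rr m e q t := size_cluster_pos hm hq ⟨(hs0 t h).1.le, h.2⟩
  set r := rr m e q t
  have ha2 := ha t (hs t h)
  have hC' := hC t (hs t h)
  have h5 : ‖(r * a' t) • ABn m e P q t‖ ≤ C * K * r := by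
    rw [norm_smul, Real.norm_eq_abs, abs_mul, abs_of_pos hr]
    calc r * |a' t| * ‖ABn m e P q t‖ ≤ 1 * (C * r) * K := by gcongr
      _ = C * K * r := by ring
  refine ⟨hz, max_le ?_ ?_, ?_⟩
  · have h6 : ‖(posVel m e q v t).im ^ 2 / r‖ ≤ D * r := by
      rw [Real.norm_eq_abs, abs_of_nonneg (by positivity), div_le_iff₀ hr]
      linarith
    have h7 : ‖r ^ 2 * dUdr m e P q t‖ ≤ B * r := by
      rw [norm_mul, Real.norm_eq_abs, Real.norm_eq_abs, abs_of_pos (by positivity)]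
      calc r ^ 2 * |dUdr m e P q t| ≤ r ^ 2 * B := by gcongr
        _ = r * (B * r) := by ring
        _ ≤ 1 * (B * r) := by gcongr
        _ = B * r := one_mul _
    have h8 := norm_add_le ((posVel m e q v t).im ^ 2 / r) (r ^ 2 * dUdr m e P q t)
    have h9 : 0 ≤ (B + C * K + K * B) * r := by positivity
    linarith
  · have h7 : ‖r ^ 2 • dUds m e P q t‖ ≤ B * r := by
      rw [norm_smul, Real.norm_eq_abs, abs_of_pos (by positivity)]
      calc r ^ 2 * ‖dUds m e P q t‖ ≤ 1 * (B * r) := by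
            gcongr
            exact pow_le_one₀ hr.le hrlt.le
        _ = B * r := one_mul _
    have h8 := norm_sub_le (r ^ 2 • dUds m e P q t) ((r * a' t) • ABn m e P q t)
    have h9 : 0 ≤ (D + B + K * B) * r := by positivity
    linarith
  · have h7 : ‖r • AdUds m e P q t‖ ≤ K * B * r := by
      rw [norm_smul, Real.norm_eq_abs, abs_of_pos hr]
      calc r * ‖AdUds m e P q t‖ ≤ 1 * (K * (B * r)) := by
            gcongr
            exact hAd.trans (by gcongr)
        _ = K * B * r := by ring
    have h8 := norm_sub_le (r • AdUds m e P q t) ((r * a' t) • ABn m e P q t)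
    have h9 : 0 ≤ (D + 2 * B) * r := by positivity
    linarith

end Final

end PartialCollision

end

/-! ### The exponential estimates in regularized time. -/

theorem mainTheorem6 {n p : ℕ} (m : Fin n → ℝ) (hm : ∀ i, 0 < m i)
    (q v : ℝ → Fin n → ℂ) (t₀ T : ℝ) (ht : t₀ < T)
    (hq : PartialCollision.IsOrbit m q v t₀ T)
    (e : Fin (p + 2) ↪ Fin n) (hcol : PartialCollision.IsPartialCollision q T e)
    (P : Matrix (Fin (p + 2)) (Fin (p + 2)) ℂ) (hP : PartialCollision.IsJacobi (m ∘ e) P)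
    (hlim : ∀ x : Fin (p + 2) → ℂ, MapClusterPt x (𝓝[<] T) (PartialCollision.qHat m e q) →
      PartialCollision.relCoord P x (Fin.last p) ≠ 0) :
    Tendsto (PartialCollision.tau m e q t₀) (𝓝[<] T) atTop ∧
    ∃ C > 0, ∃ E > 0, ∃ τ₀ : ℝ, ∀ t ∈ Ico t₀ T, τ₀ ≤ PartialCollision.tau m e q t₀ t →
      PartialCollision.zTop e P q t ≠ 0 ∧
      max
        ‖PartialCollision.mu m e P q t ^ 2 / PartialCollision.rr m e q t
            + PartialCollision.rr m e q t ^ 2 * PartialCollision.dUdr m e P q t‖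
        ‖PartialCollision.rr m e q t ^ 2 • PartialCollision.dUds m e P q t
            - (PartialCollision.rr m e q t * deriv (PartialCollision.mu m e P q) t) •
              PartialCollision.ABn m e P q t‖
        ≤ C * Real.exp (-E * PartialCollision.tau m e q t₀ t) ∧
      ‖PartialCollision.rr m e q t • PartialCollision.AdUds m e P q t
          - (PartialCollision.rr m e q t * deriv (PartialCollision.mu m e P q) t) •
            PartialCollision.ABn m e P q t‖
        ≤ C * Real.exp (-E * PartialCollision.tau m e q t₀ t) := by
  obtain ⟨t₁, ht₁, C, c, H⟩ := PartialCollision.exists_isCollapse hm ht hq hcol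
  obtain ⟨t₂, ht₂, D, hD, hasym⟩ := H.asymptotics
  have H := H.mono ht₂
  have ht₂' : t₂ ∈ Ioo t₀ T := ⟨ht₁.1.trans ht₂.1, ht₂.2⟩
  obtain ⟨htau, t₃, ht₃, E, hE, B, hB, hexp⟩ := PartialCollision.regularizedTime_asymptotics
    (τ := PartialCollision.tau m e q t₀) ht₂.2 H.c_pos hD H.r_pos H.hasDerivAt_r
    (fun t h => ⟨(hasym t h).1, (hasym t h).2.1, (hasym t h).2.2.1⟩)
    (fun t h => PartialCollision.hasDerivAt_tau hm hq ⟨ht₂'.1.trans h.1, h.2⟩) H.tendsto_r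
  obtain ⟨M, hM, t₄, ht₄, hbound⟩ := PartialCollision.exists_le_rr hm ht hP hq hcol hlim ht₂' hD
    (fun t h => (hasym t h).2.2.2) H.hasDerivAt_a H.abs_a'_le
  have ht₅ : max t₃ t₄ ∈ Ico t₀ T :=
    ⟨(ht₂'.1.trans ht₃.1).le.trans (le_max_left _ _), max_lt ht₃.2 ht₄.2⟩
  refine ⟨htau, M * B, mul_pos hM hB, E, hE,
    -- The added `1` makes `τ ≥ τ₀` exclude `t ≤ max t₃ t₄` by monotonicity of `τ`, so that both
    -- estimates, valid on open intervals, apply.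
    PartialCollision.tau m e q t₀ (max t₃ t₄) + 1, fun t h hτ => ?_⟩
  have hlt : max t₃ t₄ < t := by
    by_contra! hle
    have := PartialCollision.monotoneOn_tau (e := e) hm hq h ht₅ hle
    linarith
  have hr := mul_le_mul_of_nonneg_left (hexp t ⟨(le_max_left _ _).trans_lt hlt, h.2⟩) hM.le
  rw [← mul_assoc] at hr
  obtain ⟨hz, h1, h2⟩ := hbound t ⟨(le_max_right _ _).trans_lt hlt, h.2⟩
  exact ⟨hz, h1.trans hr, h2.trans hr⟩
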